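/- Let $N\in\{2,3\}$, $k\ge 3$, and let $H^1_r(\mathbb R^N)$ be the space of radial functions in $H^1(\mathbb R^N)$ with the norm $\|u\|^2=\int_{\mathbb R^N}|\nabla u|^2+u^2\,dx$; such functions are identified with their representatives that are continuous on $\mathbb R^N\setminus\{0\}$, and pointwise conditions refer to points $x\neq0$. Put $$J^*(W)=\tfrac12\|W\|^2-\tfrac14\int_{\mathbb R^N}W^4\,dx .$$ Let $\sigma:\{1,\dots,h\}\to\{1,\dots,k\}$ be surjective with $\sigma(l+1)\ne\sigma(l)$ for $1\le l\le h-1$, let $h_i=\#\sigma^{-1}(i)$, and for $1\le m\le h_i$ let $l(i,m)$ be the $m$-th element of $\sigma^{-1}(i)$ in increasing order. Let $\mathcal X^*$ be the set of $h$-tuples $(w_1,\dots,w_h)\in (H^1_r(\mathbb R^N))^h$ with $w_l\ge0$, $w_l\not\equiv0$, such that $w_l(x_0)>0$ implies $w_p(x)=0$ for all $|x|\ge|x_0|$ if $p<l$, and for all $|x|\le|x_0|$ if $p>l$. Let $$\mathcal N^*=\Big\{(w_l)\in\mathcal X^*:\ \|w_l\|^2=\int w_l^4\,dx\ \ \forall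 l\Big\},\qquad c_\infty=\inf_{(w_l)\in\mathcal N^*}J^*\Big(\sum_l w_l\Big),$$ $$\mathcal K=\Big\{(w_l)\in\mathcal N^*:\ J^*\Big(\sum_l w_l\Big)=c_\infty\Big\}.$$ For $0<\varepsilon\le1$ let $\mathcal X_\varepsilon$ be the set of families $(v_{im})_{1\le i\le k,\,1\le m\le h_i}$ of nonnegative functions in $H^1_r(\mathbb R^N)$ for which there is $(w_l)\in\mathcal K$ with $\sum_{i,m}\|v_{im}-w_{l(i,m)}\|^2<\varepsilon^2$, and write $V_i=\sum_{m=1}^{h_i}v_{im}$. Then there exists $\varepsilon_0\in(0,1]$ such that for every $0<\varepsilon<\varepsilon_0$ and every $(v_{im})\in\mathcal X_\varepsilon$ with $V_i\cdot V_j=0$ almost everywhere for all $i\neq j$ (while $v_{im}\cdot v_{in}$ need not vanish), $$\sup_{\lambda_{im}>0}J^*\Big(\sum_{i,m}\lambda_{im}v_{im}\Big)\ \ge\ c_\infty .$$ -/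

import Mathlib

open MeasureTheory
open scoped ContDiff

noncomputable section

namespace MixedNehari

/-- The Euclidean space `ℝ^N`. -/
abbrev Space (N : ℕ) : Type := EuclideanSpace ℝ (Fin N)

/-- `g` is the distributional gradient of `u`: both are locally integrable and
`∫ u ∂_y φ = - ∫ ⟨g, y⟩ φ` for every direction `y` and every test function `φ ∈ C_c^∞(ℝ^N)`. -/
structure HasWeakGradient {N : ℕ} (u : Space N → ℝ) (g : Space N → Space N) : Prop where
  locallyIntegrable : LocallyIntegrable u volume
  locallyIntegrable_grad : LocallyIntegrable g volume
  integral_eq : ∀ φ : Space N → ℝ, ContDiff ℝ ∞ φ → HasCompactSupport φ → ∀ y : Space N,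
    ∫ x, u x * fderiv ℝ φ x y = -∫ x, inner ℝ (g x) y * φ x

/-- The Sobolev space `H¹(ℝ^N)`: `u ∈ L²` has a weak gradient in `L²`. -/
def MemH1 {N : ℕ} (u : Space N → ℝ) : Prop :=
  MemLp u 2 volume ∧ ∃ g : Space N → Space N, HasWeakGradient u g ∧ MemLp g 2 volume

/-- The weak gradient (unique up to a null set when it exists). -/
def weakGradient {N : ℕ} (u : Space N → ℝ) : Space N → Space N :=
  open Classical in
  if h : ∃ g : Space N → Space N, HasWeakGradient u g then h.choose else 0

/-- The space of radial `H¹` functions. Every such class has a unique representative, up to its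
value at the origin, that is radial and continuous on `ℝ^N \ {0}`; this is the representative
that is used, so that functions can be evaluated at every point `x ≠ 0`. -/
structure MemH1Radial {N : ℕ} (u : Space N → ℝ) : Prop where
  memH1 : MemH1 u
  radial : ∀ x y : Space N, ‖x‖ = ‖y‖ → u x = u y
  continuousOn : ContinuousOn u {0}ᶜ

/-- The squared norm `‖u‖² = ∫ |∇u|² + u²` of `H¹(ℝ^N)`. -/
def normSq {N : ℕ} (u : Space N → ℝ) : ℝ :=
  ∫ x, (‖weakGradient u x‖ ^ 2 + u x ^ 2)

/-- The energy `J*(W) = ½ ‖W‖² - ¼ ∫ W⁴`. -/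
def energy {N : ℕ} (W : Space N → ℝ) : ℝ :=
  1 / 2 * normSq W - 1 / 4 * ∫ x, W x ^ 4

/-- The set `𝒳*` of the `h`-tuples of nodal components: nonnegative, nontrivial radial functions
whose positivity sets lie in disjoint annuli, ordered by their distance from the origin. -/
structure IsNodalTuple {N h : ℕ} (w : Fin h → Space N → ℝ) : Prop where
  mem : ∀ l, MemH1Radial (w l)
  nonneg : ∀ l, ∀ x, x ≠ 0 → 0 ≤ w l x
  nontrivial : ∀ l, ∃ x, x ≠ 0 ∧ w l x ≠ 0
  ordered_lt : ∀ l p, p < l → ∀ x₀ x : Space N, x₀ ≠ 0 → x ≠ 0 → 0 < w l x₀ →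
    ‖x₀‖ ≤ ‖x‖ → w p x = 0
  ordered_gt : ∀ l p, l < p → ∀ x₀ x : Space N, x₀ ≠ 0 → x ≠ 0 → 0 < w l x₀ →
    ‖x‖ ≤ ‖x₀‖ → w p x = 0

/-- The Nehari set `𝒩* = {W ∈ 𝒳* : ‖w_l‖² = ∫ w_l⁴ for every l}`. -/
def nehariSet (N h : ℕ) : Set (Fin h → Space N → ℝ) :=
  {w | IsNodalTuple w ∧ ∀ l, normSq (w l) = ∫ x, w l x ^ 4}

/-- The nodal Nehari level `c_∞ = inf_{W ∈ 𝒩*} J*(∑ w_l)`, as an infimum in the extended reals. -/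
def nehariLevel (N h : ℕ) : EReal :=
  ⨅ w ∈ nehariSet N h, ((energy (fun x => ∑ l, w l x) : ℝ) : EReal)

/-- The set `𝒦` of the minimizers of `J*` on the Nehari set. -/
def minimizers (N h : ℕ) : Set (Fin h → Space N → ℝ) :=
  {w | w ∈ nehariSet N h ∧ ((energy (fun x => ∑ l, w l x) : ℝ) : EReal) = nehariLevel N h}

/-- The set `σ⁻¹(i)` of the pulses that are assigned to the component `i`. -/
def fiber {h k : ℕ} (σ : Fin h → Fin k) (i : Fin k) : Finset (Fin h) :=
  {l | σ l = i}

/-- The number `h_i = #σ⁻¹(i)` of pulses of the component `i`. -/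
def pulseCount {h k : ℕ} (σ : Fin h → Fin k) (i : Fin k) : ℕ :=
  (fiber σ i).card

/-- `σ̃⁻¹(i, m)`: the `m`-th element of `σ⁻¹(i)` in increasing order. -/
def pulseIndex {h k : ℕ} (σ : Fin h → Fin k) (i : Fin k) (m : Fin (pulseCount σ i)) : Fin h :=
  (fiber σ i).orderEmbOfFin rfl m

/-- Admissible assignments of the `h` pulses to the `k` components: `σ` is onto and consecutive
pulses belong to different components. -/
structure IsAdmissible {h k : ℕ} (σ : Fin h → Fin k) : Prop where
  surjective : Function.Surjective σ
  consecutive : ∀ l l' : Fin h, (l' : ℕ) = l + 1 → σ l' ≠ σ l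

/-- A family `(v_{im})`, `i = 1, …, k`, `m = 1, …, h_i`, of functions on `ℝ^N`. -/
abbrev PulseFamily (N : ℕ) {h k : ℕ} (σ : Fin h → Fin k) : Type :=
  (i : Fin k) → Fin (pulseCount σ i) → Space N → ℝ

/-- The set `𝒳_ε` of the nonnegative families in `H¹_r` that are closer than `ε` to some
minimizer: `∑_{i,m} ‖v_{im} - w_{σ̃⁻¹(i,m)}‖² < ε²` for some `W ∈ 𝒦`. -/
def nearMinimizers (N : ℕ) {h k : ℕ} (σ : Fin h → Fin k) (ε : ℝ) : Set (PulseFamily N σ) :=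
  {v | (∀ i m, MemH1Radial (v i m)) ∧ (∀ i m, ∀ x, x ≠ 0 → 0 ≤ v i m x) ∧
    ∃ w ∈ minimizers N h,
      ∑ i, ∑ m, normSq (fun x => v i m x - w (pulseIndex σ i m) x) < ε ^ 2}

/-- The grouped component `V_i = ∑_m v_{im}`. -/
def component {N h k : ℕ} {σ : Fin h → Fin k} (v : PulseFamily N σ) (i : Fin k) : Space N → ℝ :=
  fun x => ∑ m, v i m x

end MixedNehari

end

/-!
# The energy of families near the nodal minimizers

Let `w` be a minimizer and let `v_q` be close to its component `w_q`. No compactness of the set of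
minimizers and no regularity of its elements is used; all estimates are uniform because the norms
of the components lie between two positive constants.

* *Radial calculus.* A radial function that vanishes on a sphere can be cut off along it, and the
  weak gradient is cut off with it (`HasWeakGradient.indicator_ball`, `Splits`). The radial lemma
  `exists_sq_le_weight_mul_normSq` bounds a radial function pointwise by its norm, hence gives the
  embedding into `L⁴` (`exists_sobolev`), and shows that functions on the Nehari manifold have a
  peak of definite height (`exists_peak`).

* *Separation.* Consecutive pulses belong to components with disjoint supports, so between the
  peaks of `v_l` and `v_{l+1}` there is a sphere on which every `v_q` vanishes: the first zero of
  the component of `v_l` after its peak (`exists_common_zero`). These spheres bound annuli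
  `A_1, …, A_h`.

* *Concentration.* On such a sphere, `w_q` can be modified to a nearby `y ≤ w_q` that vanishes there
  (`exists_truncation`). If `a` and `b` are the parts of `y` inside and outside the sphere,
  minimality of `w` gives `‖w_q‖² ∫ a⁴ ≤ ‖a‖⁴`, and the same for `b` (`normSq_mul_integral_le`).
  Adding the two, `2 ‖a‖² ‖b‖² ≤ ‖y‖⁴ - ‖w_q‖² ∫ y⁴`, which is small since `y` is close to `w_q` and
  `‖w_q‖² = ∫ w_q⁴`. So `v_q` has almost no mass on the side of the sphere that does not contain
  its peak (`exists_split_bound`, `exists_peaks`), that is, `v_q` is concentrated on `A_q`.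

* *Projection to the Nehari set.* Since `1_{A_l} v_q` is small for `q ≠ l` and close to `w_l` for
  `q = l`, the system `‖1_{A_l} ∑ t_q v_q‖² = ∫_{A_l} (∑ t_q v_q)⁴`, `1 ≤ l ≤ h`, is a small
  perturbation of the decoupled system `t_l² = t_l⁴`, whose solution `(1, …, 1)` is nondegenerate.
  So it has a positive solution (`exists_solution_perturbedSystem`, `exists_nehari_combination`).
  For this `t`, the restrictions of `∑ t_q v_q` to the annuli form an element of the Nehari set, so
  the energy of `∑ t_q v_q` is at least the Nehari level (`exists_combination_energy_ge`).
-/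

noncomputable section

namespace MixedNehari

variable {N : ℕ}

/-! ### Weak gradients -/

theorem integrable_mul_testFunction {u φ : Space N → ℝ} (hu : LocallyIntegrable u volume)
    (hφ : Continuous φ) (hc : HasCompactSupport φ) : Integrable (fun x => u x * φ x) := by
  simpa [mul_comm] using hu.integrable_smul_left_of_hasCompactSupport hφ hc

theorem continuous_fderiv_apply_test {φ : Space N → ℝ} (hφ : ContDiff ℝ ∞ φ) (y : Space N) :
    Continuous fun x => fderiv ℝ φ x y :=
  (hφ.continuous_fderiv (by simp)).clm_apply continuous_const

theorem HasWeakGradient.integrable_left {u : Space N → ℝ} {g : Space N → Space N}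
    (h : HasWeakGradient u g) {φ : Space N → ℝ} (hφ : ContDiff ℝ ∞ φ) (hc : HasCompactSupport φ)
    (y : Space N) : Integrable (fun x => u x * fderiv ℝ φ x y) :=
  integrable_mul_testFunction h.locallyIntegrable (continuous_fderiv_apply_test hφ y)
    (hc.fderiv_apply (𝕜 := ℝ) y)

theorem locallyIntegrable_inner {g : Space N → Space N} (hg : LocallyIntegrable g volume)
    (y : Space N) : LocallyIntegrable (fun x => inner ℝ (g x) y) volume := by
  intro x
  obtain ⟨s, hs, h⟩ := hg x
  exact ⟨s, hs, Integrable.inner_const h y⟩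

theorem HasWeakGradient.integrable_right {u : Space N → ℝ} {g : Space N → Space N}
    (h : HasWeakGradient u g) {φ : Space N → ℝ} (hφ : Continuous φ) (hc : HasCompactSupport φ)
    (y : Space N) : Integrable (fun x => inner ℝ (g x) y * φ x) :=
  integrable_mul_testFunction (locallyIntegrable_inner h.locallyIntegrable_grad y) hφ hc

theorem HasWeakGradient.ae_unique {u u' : Space N → ℝ} {g g' : Space N → Space N}
    (h : HasWeakGradient u g) (h' : HasWeakGradient u' g') (huu' : u =ᵐ[volume] u') :
    g =ᵐ[volume] g' := by
  refine ae_eq_of_integral_contDiff_smul_eq h.locallyIntegrable_grad h'.locallyIntegrable_grad ?_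
  intro φ hφ hc
  have i1 := h.locallyIntegrable_grad.integrable_smul_left_of_hasCompactSupport hφ.continuous hc
  have i2 := h'.locallyIntegrable_grad.integrable_smul_left_of_hasCompactSupport hφ.continuous hc
  refine ext_inner_left ℝ fun y => ?_
  rw [← integral_inner i1, ← integral_inner i2]
  have e1 := h.integral_eq φ hφ hc y
  have e2 := h'.integral_eq φ hφ hc y
  have e3 : ∫ x, u x * fderiv ℝ φ x y = ∫ x, u' x * fderiv ℝ φ x y :=
    integral_congr_ae (huu'.mono fun x hx => by simp only [hx])
  have e4 : ∫ x, inner ℝ (g x) y * φ x = ∫ x, inner ℝ (g' x) y * φ x := by linarith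
  simpa [real_inner_smul_right, real_inner_comm, mul_comm] using e4

theorem HasWeakGradient.weakGradient_spec {u : Space N → ℝ} {g : Space N → Space N}
    (h : HasWeakGradient u g) : HasWeakGradient u (weakGradient u) := by
  have hex : ∃ g, HasWeakGradient u g := ⟨g, h⟩
  unfold weakGradient
  rw [dif_pos hex]
  exact hex.choose_spec

theorem HasWeakGradient.weakGradient_ae {u : Space N → ℝ} {g : Space N → Space N}
    (h : HasWeakGradient u g) : weakGradient u =ᵐ[volume] g :=
  h.weakGradient_spec.ae_unique h .rfl

theorem HasWeakGradient.add {u v : Space N → ℝ} {g g' : Space N → Space N}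
    (hu : HasWeakGradient u g) (hv : HasWeakGradient v g') :
    HasWeakGradient (u + v) (g + g') where
  locallyIntegrable := hu.locallyIntegrable.add hv.locallyIntegrable
  locallyIntegrable_grad := hu.locallyIntegrable_grad.add hv.locallyIntegrable_grad
  integral_eq φ hφ hc y := by
    simp only [Pi.add_apply, add_mul, inner_add_left]
    rw [integral_add (hu.integrable_left hφ hc y) (hv.integrable_left hφ hc y),
      integral_add (hu.integrable_right hφ.continuous hc y)
        (hv.integrable_right hφ.continuous hc y),
      hu.integral_eq φ hφ hc y, hv.integral_eq φ hφ hc y]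
    ring

theorem HasWeakGradient.const_smul {u : Space N → ℝ} {g : Space N → Space N}
    (hu : HasWeakGradient u g) (c : ℝ) : HasWeakGradient (c • u) (c • g) where
  locallyIntegrable := hu.locallyIntegrable.smul c
  locallyIntegrable_grad := hu.locallyIntegrable_grad.smul c
  integral_eq φ hφ hc y := by
    simp only [Pi.smul_apply, smul_eq_mul, real_inner_smul_left, mul_assoc]
    rw [integral_const_mul, integral_const_mul, hu.integral_eq φ hφ hc y]
    ring

theorem HasWeakGradient.zero : HasWeakGradient (0 : Space N → ℝ) 0 where
  locallyIntegrable := locallyIntegrable_zero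
  locallyIntegrable_grad := locallyIntegrable_zero
  integral_eq φ hφ hc y := by simp

theorem MemH1.hasWeakGradient {u : Space N → ℝ} (h : MemH1 u) :
    HasWeakGradient u (weakGradient u) :=
  h.2.choose_spec.1.weakGradient_spec

theorem MemH1.memLp_weakGradient {u : Space N → ℝ} (h : MemH1 u) :
    MemLp (weakGradient u) 2 volume :=
  h.2.choose_spec.2.ae_eq h.2.choose_spec.1.weakGradient_ae.symm

/-- The radial Sobolev functions form a vector space. -/
def radialH1 (N : ℕ) : Submodule ℝ (Space N → ℝ) where
  carrier := {u | MemH1Radial u}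
  add_mem' {u v} hu hv :=
    { memH1 := ⟨hu.memH1.1.add hv.memH1.1, _, hu.memH1.hasWeakGradient.add hv.memH1.hasWeakGradient,
        hu.memH1.memLp_weakGradient.add hv.memH1.memLp_weakGradient⟩
      radial := fun x y h => by simp [hu.radial x y h, hv.radial x y h]
      continuousOn := hu.continuousOn.add hv.continuousOn }
  zero_mem' :=
    { memH1 := ⟨MemLp.zero', 0, .zero, MemLp.zero'⟩
      radial := fun x y h => rfl
      continuousOn := continuousOn_const }
  smul_mem' c u hu :=
    { memH1 := ⟨hu.memH1.1.const_smul c, _, hu.memH1.hasWeakGradient.const_smul c,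
        hu.memH1.memLp_weakGradient.const_smul c⟩
      radial := fun x y h => by simp [hu.radial x y h]
      continuousOn := hu.continuousOn.const_smul c }

/-- The Hilbert space `L² × L²` that receives a function together with its weak gradient. -/
abbrev GraphSpace (N : ℕ) : Type :=
  WithLp 2 (Lp ℝ 2 (volume : Measure (Space N)) × Lp (Space N) 2 (volume : Measure (Space N)))

/-- The isometric embedding `u ↦ (u, ∇u)` of the radial Sobolev functions into `L² × L²`. -/
def graphMap (N : ℕ) : radialH1 N →ₗ[ℝ] GraphSpace N where
  toFun u := WithLp.toLp 2 (u.2.memH1.1.toLp, u.2.memH1.memLp_weakGradient.toLp)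
  map_add' u v := by
    rw [← WithLp.toLp_add, Prod.mk_add_mk]
    congr 2
    rw [← MemLp.toLp_add]
    exact MemLp.toLp_congr _ _
      (u.2.memH1.hasWeakGradient.add v.2.memH1.hasWeakGradient).weakGradient_ae
  map_smul' c u := by
    rw [RingHom.id_apply, ← WithLp.toLp_smul, Prod.smul_mk]
    congr 2
    rw [← MemLp.toLp_const_smul]
    exact MemLp.toLp_congr _ _ (u.2.memH1.hasWeakGradient.const_smul c).weakGradient_ae

theorem inner_graphMap (u v : radialH1 N) :
    inner ℝ (graphMap N u) (graphMap N v) = (∫ x, u.1 x * v.1 x) +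
      ∫ x, inner ℝ (weakGradient u.1 x) (weakGradient v.1 x) := by
  rw [WithLp.prod_inner_apply, L2.inner_def, L2.inner_def]
  congr 1
  · refine integral_congr_ae ?_
    filter_upwards [u.2.memH1.1.coeFn_toLp, v.2.memH1.1.coeFn_toLp] with x h1 h2
    simp only [graphMap, LinearMap.coe_mk, AddHom.coe_mk, h1, h2]
    simp [mul_comm]
  · refine integral_congr_ae ?_
    filter_upwards [u.2.memH1.memLp_weakGradient.coeFn_toLp,
      v.2.memH1.memLp_weakGradient.coeFn_toLp] with x h1 h2
    simp only [graphMap, LinearMap.coe_mk, AddHom.coe_mk, h1, h2]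

theorem MemH1.integrable_sq {u : Space N → ℝ} (h : MemH1 u) : Integrable fun x => u x ^ 2 :=
  h.1.integrable_sq

theorem MemH1.integrable_grad_sq {u : Space N → ℝ} (h : MemH1 u) :
    Integrable fun x => ‖weakGradient u x‖ ^ 2 :=
  h.memLp_weakGradient.integrable_norm_pow (by norm_num)

theorem MemH1.normSq_eq {u : Space N → ℝ} (h : MemH1 u) :
    normSq u = (∫ x, u x ^ 2) + ∫ x, ‖weakGradient u x‖ ^ 2 := by
  rw [normSq, integral_add h.integrable_grad_sq h.integrable_sq, add_comm]

theorem norm_graphMap_sq (u : radialH1 N) : ‖graphMap N u‖ ^ 2 = normSq u.1 := by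
  rw [← real_inner_self_eq_norm_sq, inner_graphMap, u.2.memH1.normSq_eq]
  simp [sq]

theorem normSq_eq_norm_sq {u : Space N → ℝ} (h : MemH1Radial u) :
    normSq u = ‖graphMap N ⟨u, h⟩‖ ^ 2 := (norm_graphMap_sq ⟨u, h⟩).symm

theorem MemH1Radial.sub {u v : Space N → ℝ} (hu : MemH1Radial u) (hv : MemH1Radial v) :
    MemH1Radial (u - v) := (radialH1 N).sub_mem hu hv

theorem MemH1Radial.add {u v : Space N → ℝ} (hu : MemH1Radial u) (hv : MemH1Radial v) :
    MemH1Radial (u + v) := (radialH1 N).add_mem hu hv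

theorem MemH1Radial.smul {u : Space N → ℝ} (hu : MemH1Radial u) (c : ℝ) :
    MemH1Radial (c • u) := (radialH1 N).smul_mem c hu

theorem normSq_nonneg (u : Space N → ℝ) : 0 ≤ normSq u :=
  integral_nonneg fun x => by positivity

theorem normSq_smul {u : Space N → ℝ} (hu : MemH1Radial u) (c : ℝ) :
    normSq (c • u) = c ^ 2 * normSq u := by
  have := norm_graphMap_sq (c • (⟨u, hu⟩ : radialH1 N))
  rw [map_smul, norm_smul, mul_pow, norm_graphMap_sq] at this
  simpa using this.symm

theorem sqrt_normSq {u : Space N → ℝ} (h : MemH1Radial u) :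
    √(normSq u) = ‖graphMap N ⟨u, h⟩‖ := by
  rw [normSq_eq_norm_sq h, Real.sqrt_sq (norm_nonneg _)]

theorem sqrt_normSq_add_le {u v : Space N → ℝ} (hu : MemH1Radial u) (hv : MemH1Radial v) :
    √(normSq (u + v)) ≤ √(normSq u) + √(normSq v) := by
  rw [sqrt_normSq hu, sqrt_normSq hv, sqrt_normSq (hu.add hv)]
  exact norm_add_le (graphMap N ⟨u, hu⟩) (graphMap N ⟨v, hv⟩) |>.trans' (by rw [← map_add]; rfl)

/-! ### Cutting a radial function along a sphere on which it vanishes -/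

/-- A fixed unit vector of `ℝ^N`. -/
def unitVec (N : ℕ) [NeZero N] : Space N := EuclideanSpace.single 0 1

@[simp] theorem norm_unitVec [NeZero N] : ‖unitVec N‖ = 1 := by simp [unitVec]

theorem unitVec_ne_zero [NeZero N] : unitVec N ≠ 0 := by
  intro h
  have := norm_unitVec (N := N)
  simp [h] at this

theorem norm_smul_unitVec [NeZero N] {t : ℝ} (ht : 0 ≤ t) : ‖t • unitVec N‖ = t := by
  simp [norm_smul, abs_of_nonneg ht]

/-- The values of a radial function on a half-line, as a function of the radius. -/
def profile [NeZero N] (u : Space N → ℝ) (t : ℝ) : ℝ := u (t • unitVec N)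

theorem MemH1Radial.eq_profile [NeZero N] {u : Space N → ℝ} (hu : MemH1Radial u) (x : Space N) :
    u x = profile u ‖x‖ :=
  hu.radial _ _ (by rw [norm_smul_unitVec (norm_nonneg x)])

theorem MemH1Radial.continuousOn_profile [NeZero N] {u : Space N → ℝ} (hu : MemH1Radial u) :
    ContinuousOn (profile u) (Set.Ioi 0) := by
  refine hu.continuousOn.comp (by fun_prop) fun t ht => ?_
  simp only [Set.mem_compl_iff, Set.mem_singleton_iff, smul_eq_zero, not_or]
  exact ⟨ne_of_gt ht, unitVec_ne_zero⟩

theorem MemH1Radial.exists_abs_le_near_sphere [NeZero N] {u : Space N → ℝ} (hu : MemH1Radial u)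
    {s : ℝ} (hs : 0 < s) (h0 : ∀ x, ‖x‖ = s → u x = 0) {ε : ℝ} (hε : 0 < ε) :
    ∃ δ > 0, ∀ x, |‖x‖ - s| < δ → |u x| ≤ ε := by
  have hc := hu.continuousOn_profile.continuousAt (Ioi_mem_nhds hs)
  have h1 : profile u s = 0 := h0 _ (norm_smul_unitVec hs.le)
  obtain ⟨δ, hδ, h⟩ := Metric.continuousAt_iff.1 hc ε hε
  refine ⟨δ, hδ, fun x hx => ?_⟩
  have := h (x := ‖x‖) (by rwa [Real.dist_eq])
  rw [h1, Real.dist_eq, sub_zero, ← hu.eq_profile] at this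
  exact this.le

theorem continuous_deriv_smoothTransition : Continuous (deriv Real.smoothTransition) :=
  (Real.smoothTransition.contDiff (n := 1)).continuous_deriv le_rfl

theorem deriv_smoothTransition_of_nonpos {t : ℝ} (ht : t ≤ 0) :
    deriv Real.smoothTransition t = 0 := by
  have hneg : ∀ t < 0, deriv Real.smoothTransition t = 0 := by
    intro t ht
    have : Real.smoothTransition =ᶠ[nhds t] fun _ => 0 := by
      filter_upwards [gt_mem_nhds ht] with x hx
      exact Real.smoothTransition.zero_of_nonpos hx.le
    simp [this.deriv_eq]
  have hcl : IsClosed {t | deriv Real.smoothTransition t = 0} :=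
    isClosed_eq continuous_deriv_smoothTransition continuous_const
  have : closure (Set.Iio (0 : ℝ)) ⊆ {t | deriv Real.smoothTransition t = 0} :=
    hcl.closure_subset_iff.2 hneg
  rw [closure_Iio] at this
  exact this ht

theorem deriv_smoothTransition_of_one_le {t : ℝ} (ht : 1 ≤ t) :
    deriv Real.smoothTransition t = 0 := by
  have hpos : ∀ t > 1, deriv Real.smoothTransition t = 0 := by
    intro t ht
    have : Real.smoothTransition =ᶠ[nhds t] fun _ => 1 := by
      filter_upwards [lt_mem_nhds ht] with x hx
      exact Real.smoothTransition.one_of_one_le hx.le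
    simp [this.deriv_eq]
  have hcl : IsClosed {t | deriv Real.smoothTransition t = 0} :=
    isClosed_eq continuous_deriv_smoothTransition continuous_const
  have : closure (Set.Ioi (1 : ℝ)) ⊆ {t | deriv Real.smoothTransition t = 0} :=
    hcl.closure_subset_iff.2 hpos
  rw [closure_Ioi] at this
  exact this ht

theorem exists_abs_deriv_smoothTransition_le :
    ∃ C : ℝ, 0 ≤ C ∧ ∀ t, |deriv Real.smoothTransition t| ≤ C := by
  obtain ⟨C, hC⟩ := (isCompact_Icc (a := (0 : ℝ)) (b := 1)).exists_bound_of_continuousOn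
    continuous_deriv_smoothTransition.continuousOn
  refine ⟨max C 0, le_max_right _ _, fun t => ?_⟩
  rcases le_total t 0 with ht0 | ht0
  · simp [deriv_smoothTransition_of_nonpos ht0]
  rcases le_total 1 t with ht1 | ht1
  · simp [deriv_smoothTransition_of_one_le ht1]
  exact (hC t ⟨ht0, ht1⟩).trans (le_max_left _ _)

/-- Smooth radial cutoffs that increase to the indicator function of the ball of radius `s`. -/
def cutoff (s : ℝ) (n : ℕ) (x : Space N) : ℝ :=
  Real.smoothTransition ((n + 1) * (1 - ‖x‖ ^ 2 / s ^ 2))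

theorem contDiff_cutoff (s : ℝ) (n : ℕ) : ContDiff ℝ ∞ (cutoff (N := N) s n) := by
  refine (Real.smoothTransition.contDiff (n := ⊤)).comp ?_
  exact contDiff_const.mul (contDiff_const.sub ((contDiff_norm_sq ℝ).div_const _))

theorem fderiv_cutoff (s : ℝ) (n : ℕ) (x y : Space N) :
    fderiv ℝ (cutoff s n) x y = deriv Real.smoothTransition ((n + 1) * (1 - ‖x‖ ^ 2 / s ^ 2)) *
      ((n + 1) * (-(2 * inner ℝ x y / s ^ 2))) := by
  have h1 : HasFDerivAt (fun x : Space N => ‖x‖ ^ 2) (2 • innerSL ℝ x) x :=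
    (hasStrictFDerivAt_norm_sq x).hasFDerivAt
  have h2 := ((h1.mul_const (s ^ 2)⁻¹).const_sub 1).const_mul ((n : ℝ) + 1)
  have h3 : HasDerivAt Real.smoothTransition
      (deriv Real.smoothTransition ((n + 1) * (1 - ‖x‖ ^ 2 * (s ^ 2)⁻¹)))
      ((n + 1) * (1 - ‖x‖ ^ 2 * (s ^ 2)⁻¹)) :=
    ((Real.smoothTransition.contDiff (n := 1)).differentiable (by simp) _).hasDerivAt
  have h4 := h3.comp_hasFDerivAt x h2
  have h5 : cutoff (N := N) s n =
      Real.smoothTransition ∘ fun x => ((n : ℝ) + 1) * (1 - ‖x‖ ^ 2 * (s ^ 2)⁻¹) := by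
    ext z; simp [cutoff, div_eq_mul_inv]
  rw [h5, h4.fderiv]
  simp only [div_eq_mul_inv, smul_apply, neg_apply,
    innerSL_apply_apply, smul_eq_mul, nsmul_eq_mul, Nat.cast_ofNat]
  ring

theorem cutoff_eq_zero {s : ℝ} (hs : 0 < s) (n : ℕ) {x : Space N} (hx : s ≤ ‖x‖) :
    cutoff s n x = 0 := by
  refine Real.smoothTransition.zero_of_nonpos ?_
  refine mul_nonpos_of_nonneg_of_nonpos (by positivity) ?_
  rw [sub_nonpos, one_le_div (by positivity)]
  gcongr

theorem abs_cutoff_le_one (s : ℝ) (n : ℕ) (x : Space N) : |cutoff s n x| ≤ 1 := by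
  rw [cutoff, abs_of_nonneg (Real.smoothTransition.nonneg _)]
  exact Real.smoothTransition.le_one _

theorem tendsto_cutoff {s : ℝ} (hs : 0 < s) (x : Space N) :
    Filter.Tendsto (fun n => cutoff s n x) Filter.atTop
      (nhds ((Metric.ball 0 s).indicator (fun _ => 1) x)) := by
  by_cases hx : ‖x‖ < s
  · rw [Set.indicator_of_mem (by simpa using hx)]
    have hpos : 0 < 1 - ‖x‖ ^ 2 / s ^ 2 := by
      rw [sub_pos, div_lt_one (by positivity)]
      gcongr
    obtain ⟨n₀, hn₀⟩ := exists_nat_ge (1 / (1 - ‖x‖ ^ 2 / s ^ 2))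
    refine tendsto_const_nhds.congr' ?_
    filter_upwards [Filter.eventually_ge_atTop n₀] with n hn
    refine (Real.smoothTransition.one_of_one_le ?_).symm
    rw [div_le_iff₀ hpos] at hn₀
    have : (n₀ : ℝ) ≤ n + 1 := by
      have : (n₀ : ℝ) ≤ n := by exact_mod_cast hn
      linarith
    nlinarith
  · rw [Set.indicator_of_notMem (by simpa using hx)]
    exact tendsto_const_nhds.congr fun n => (cutoff_eq_zero hs n (not_lt.1 hx)).symm

theorem fderiv_cutoff_eq_zero {s : ℝ} (hs : 0 < s) (n : ℕ) {x : Space N}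
    (hx : x ∉ Metric.ball (0 : Space N) s \ Metric.ball 0 (s * (1 - 1 / (n + 1)))) (hxs : ‖x‖ ≠ s)
    (y : Space N) : fderiv ℝ (cutoff s n) x y = 0 := by
  have hn : (0 : ℝ) < n + 1 := by positivity
  rw [fderiv_cutoff]
  rcases lt_or_gt_of_ne hxs with h | h
  · have h1 : ‖x‖ < s * (1 - 1 / (n + 1)) := by
      by_contra h'
      exact hx ⟨by simpa using h, by simpa using h'⟩
    have h2 : ‖x‖ / s < 1 - 1 / (n + 1) := by
      rw [div_lt_iff₀ hs]; linarith
    have h0 : 0 ≤ ‖x‖ / s := by positivity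
    have h3 : 1 < (n + 1) * (1 - ‖x‖ ^ 2 / s ^ 2) := by
      rw [← div_pow]
      have : (‖x‖ / s) ^ 2 < 1 - 1 / (n + 1) := by
        have : (1 : ℝ) / (n + 1) > 0 := by positivity
        nlinarith
      calc (1 : ℝ) = (n + 1) * (1 / (n + 1)) := by field_simp
        _ < _ := by gcongr; linarith
    rw [deriv_smoothTransition_of_one_le h3.le, zero_mul]
  · have h3 : (n + 1) * (1 - ‖x‖ ^ 2 / s ^ 2) < 0 := by
      refine mul_neg_of_pos_of_neg hn ?_
      rw [sub_neg, one_lt_div (by positivity)]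
      gcongr
    rw [deriv_smoothTransition_of_nonpos h3.le, zero_mul]

/-- The shell that carries the derivative of the `n`-th cutoff has volume of order `1 / n`. -/
theorem mul_volume_shell_le {s : ℝ} (hs : 0 < s) (n : ℕ) [NeZero N] :
    (n + 1) * volume.real (Metric.ball (0 : Space N) s \ Metric.ball 0 (s * (1 - 1 / (n + 1)))) ≤
      N * volume.real (Metric.ball (0 : Space N) s) := by
  have hn : (0 : ℝ) < n + 1 := by positivity
  have h1 : (0 : ℝ) ≤ 1 - 1 / (n + 1) := by
    rw [sub_nonneg, div_le_one hn]
    have : (0 : ℝ) ≤ n := by positivity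
    linarith
  have hr : s * (1 - 1 / (n + 1)) ≤ s := by
    have : (0 : ℝ) < 1 / (n + 1) := by positivity
    nlinarith
  rw [measureReal_sdiff (Metric.ball_subset_ball hr) measurableSet_ball]
  have hb : ∀ r : ℝ, 0 ≤ r → volume.real (Metric.ball (0 : Space N) r) =
      r ^ N * volume.real (Metric.ball (0 : Space N) 1) := by
    intro r hr
    rw [measureReal_def, Measure.addHaar_ball _ _ hr, ENNReal.toReal_mul,
      ENNReal.toReal_ofReal (by positivity), measureReal_def]
    simp
  rw [hb _ hs.le, hb _ (mul_nonneg hs.le h1)]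
  have hbern := one_add_mul_le_pow (a := -(1 / ((n : ℝ) + 1))) (by linarith) N
  have hV : 0 ≤ volume.real (Metric.ball (0 : Space N) 1) := measureReal_nonneg
  have hb2 : 1 - (1 + -(1 / ((n : ℝ) + 1))) ^ N ≤ N * (1 / (n + 1)) := by linarith
  calc _ = (n + 1) * (1 - (1 + -(1 / ((n : ℝ) + 1))) ^ N) *
        (s ^ N * volume.real (Metric.ball (0 : Space N) 1)) := by rw [mul_pow]; ring
    _ ≤ (n + 1) * (N * (1 / (n + 1))) * (s ^ N * volume.real (Metric.ball (0 : Space N) 1)) := by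
        gcongr
    _ = _ := by field_simp

theorem locallyIntegrable_indicator {F : Type*} [NormedAddCommGroup F] {f : Space N → F}
    (hf : LocallyIntegrable f volume) {B : Set (Space N)} (hB : MeasurableSet B) :
    LocallyIntegrable (B.indicator f) volume := by
  intro x
  obtain ⟨s, hs, h⟩ := hf x
  exact ⟨s, hs, IntegrableOn.indicator h hB⟩

/-- The term in which the derivative falls on the cutoff tends to zero: the derivative is of order
`n` on a shell of volume of order `1 / n`, on which the function is uniformly small. -/
theorem tendsto_integral_mul_fderiv_cutoff [NeZero N] {u : Space N → ℝ} (hu : MemH1Radial u)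
    {s : ℝ} (hs : 0 < s) (h0 : ∀ x, ‖x‖ = s → u x = 0) {φ : Space N → ℝ} (hφ : Continuous φ)
    (hc : HasCompactSupport φ) (y : Space N) :
    Filter.Tendsto (fun n : ℕ => ∫ x, u x * (φ x * fderiv ℝ (cutoff s n) x y)) Filter.atTop
      (nhds 0) := by
  obtain ⟨C, hC0, hC⟩ := exists_abs_deriv_smoothTransition_le
  obtain ⟨D, hD⟩ := hc.exists_bound_of_continuous hφ
  have hD0 : 0 ≤ D := (norm_nonneg _).trans (hD 0)
  set V := volume.real (Metric.ball (0 : Space N) s) with hV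
  have hV0 : 0 ≤ V := measureReal_nonneg
  set M : ℝ := D * (C * (2 * ‖y‖ / s)) * (N * V) with hM
  have hM0 : 0 ≤ M := by positivity
  rw [Metric.tendsto_atTop]
  intro ε hε
  obtain ⟨δ, hδ, hsmall⟩ := hu.exists_abs_le_near_sphere hs h0 (ε := ε / (M + 1)) (by positivity)
  obtain ⟨n₀, hn₀⟩ := exists_nat_gt (s / δ)
  refine ⟨n₀, fun n hn => ?_⟩
  have hn1 : (0 : ℝ) < n + 1 := by positivity
  set S := Metric.ball (0 : Space N) s \ Metric.ball 0 (s * (1 - 1 / (n + 1))) with hS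
  have hnδ : s / (n + 1) < δ := by
    rw [div_lt_iff₀ hn1]
    rw [div_lt_iff₀ hδ] at hn₀
    have : (n₀ : ℝ) ≤ n := by exact_mod_cast hn
    nlinarith
  have hbound : ∀ x, ‖u x * (φ x * fderiv ℝ (cutoff s n) x y)‖ ≤
      S.indicator (fun _ => ε / (M + 1) * (D * (C * ((n + 1) * (2 * ‖y‖ / s))))) x := by
    intro x
    by_cases hx : x ∈ S
    · rw [Set.indicator_of_mem hx]
      have hx1 : ‖x‖ < s := by simpa using hx.1
      have hx2 : s * (1 - 1 / (n + 1)) ≤ ‖x‖ := by simpa using hx.2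
      have hx3 : |‖x‖ - s| < δ := by
        rw [abs_lt]
        constructor
        · have : s * (1 - 1 / ((n : ℝ) + 1)) = s - s / (n + 1) := by ring
          linarith
        · linarith
      rw [norm_mul, norm_mul, Real.norm_eq_abs (u x), fderiv_cutoff, norm_mul]
      gcongr
      · exact hsmall x hx3
      · exact hD x
      · exact hC _
      · rw [norm_mul, norm_neg, Real.norm_eq_abs, abs_of_pos hn1]
        gcongr
        rw [norm_div, norm_mul, Real.norm_eq_abs (2 : ℝ), abs_of_pos (by norm_num : (0 : ℝ) < 2),
          Real.norm_eq_abs (s ^ 2), abs_of_pos (by positivity : 0 < s ^ 2),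
          div_le_div_iff₀ (by positivity) hs]
        have := norm_inner_le_norm (𝕜 := ℝ) x y
        have h2 : ‖inner ℝ x y‖ ≤ s * ‖y‖ := this.trans (by gcongr)
        nlinarith
    · rw [Set.indicator_of_notMem hx]
      by_cases hxs : ‖x‖ = s
      · simp [h0 x hxs]
      · simp [fderiv_cutoff_eq_zero hs n hx hxs]
  have hSm : MeasurableSet S := measurableSet_ball.diff measurableSet_ball
  have hSfin : volume S ≠ ⊤ :=
    ((measure_mono Set.sdiff_subset).trans_lt measure_ball_lt_top).ne
  have hi : Integrable (S.indicator
      (fun _ => ε / (M + 1) * (D * (C * ((n + 1) * (2 * ‖y‖ / s)))))) :=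
    (integrable_indicator_iff hSm).2 (integrableOn_const hSfin)
  rw [dist_zero_right]
  calc _ ≤ ∫ x, S.indicator (fun _ => ε / (M + 1) * (D * (C * ((n + 1) * (2 * ‖y‖ / s))))) x :=
        norm_integral_le_of_norm_le hi (.of_forall hbound)
    _ = ε / (M + 1) * (D * (C * (2 * ‖y‖ / s))) * ((n + 1) * volume.real S) := by
        rw [integral_indicator hSm, setIntegral_const, smul_eq_mul]
        ring
    _ ≤ ε / (M + 1) * (D * (C * (2 * ‖y‖ / s))) * (N * V) := by
        exact mul_le_mul_of_nonneg_left (mul_volume_shell_le hs n) (by positivity)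
    _ = ε * (M / (M + 1)) := by rw [hM]; ring
    _ < ε * 1 := by
        gcongr
        rw [div_lt_one (by positivity)]
        linarith
    _ = ε := mul_one _

theorem tendsto_integral_mul_cutoff {s : ℝ} (hs : 0 < s) {f : Space N → ℝ} (hf : Integrable f) :
    Filter.Tendsto (fun n : ℕ => ∫ x, cutoff s n x * f x) Filter.atTop
      (nhds (∫ x, (Metric.ball 0 s).indicator f x)) := by
  refine tendsto_integral_of_dominated_convergence (fun x => ‖f x‖) (fun n => ?_) hf.norm
    (fun n => .of_forall fun x => ?_) (.of_forall fun x => ?_)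
  · exact (contDiff_cutoff s n).continuous.aestronglyMeasurable.mul hf.1
  · rw [norm_mul]
    exact mul_le_of_le_one_left (norm_nonneg _) (abs_cutoff_le_one s n x)
  · have := (tendsto_cutoff hs x).mul_const (f x)
    convert this using 2
    by_cases hx : x ∈ Metric.ball (0 : Space N) s <;> simp [hx]

/-- If a radial function vanishes on a sphere, its restriction to the ball has the restricted weak
gradient. This is integration by parts against test functions multiplied by smooth cutoffs of the
ball. -/
theorem HasWeakGradient.indicator_ball [NeZero N] {u : Space N → ℝ} {g : Space N → Space N}
    (hg : HasWeakGradient u g) (hu : MemH1Radial u) {s : ℝ} (hs : 0 < s)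
    (h0 : ∀ x, ‖x‖ = s → u x = 0) :
    HasWeakGradient ((Metric.ball 0 s).indicator u) ((Metric.ball 0 s).indicator g) where
  locallyIntegrable := locallyIntegrable_indicator hg.locallyIntegrable measurableSet_ball
  locallyIntegrable_grad := locallyIntegrable_indicator hg.locallyIntegrable_grad measurableSet_ball
  integral_eq φ hφ hc y := by
    have t1 := tendsto_integral_mul_cutoff hs (hg.integrable_left hφ hc y)
    have t2 := tendsto_integral_mul_cutoff hs (hg.integrable_right hφ.continuous hc y)
    have t3 := tendsto_integral_mul_fderiv_cutoff hu hs h0 hφ.continuous hc y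
    have e1 : ∫ x, (Metric.ball 0 s).indicator u x * fderiv ℝ φ x y =
        ∫ x, (Metric.ball 0 s).indicator (fun x => u x * fderiv ℝ φ x y) x :=
      integral_congr_ae (.of_forall fun x => by
        by_cases hx : x ∈ Metric.ball (0 : Space N) s <;> simp [hx])
    have e2 : ∫ x, inner ℝ ((Metric.ball 0 s).indicator g x) y * φ x =
        ∫ x, (Metric.ball 0 s).indicator (fun x => inner ℝ (g x) y * φ x) x :=
      integral_congr_ae (.of_forall fun x => by
        by_cases hx : x ∈ Metric.ball (0 : Space N) s <;> simp [hx])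
    rw [e1, e2]
    have key : ∀ n : ℕ, (∫ x, cutoff s n x * (u x * fderiv ℝ φ x y)) +
        (∫ x, u x * (φ x * fderiv ℝ (cutoff s n) x y)) =
        -∫ x, cutoff s n x * (inner ℝ (g x) y * φ x) := by
      intro n
      have hη := contDiff_cutoff (N := N) s n
      have hcη : HasCompactSupport (fun x => cutoff s n x * φ x) := hc.mul_left
      have h1 := hg.integral_eq _ (hη.mul hφ) hcη y
      have hf : ∀ x, fderiv ℝ (fun x => cutoff s n x * φ x) x y =
          cutoff s n x * fderiv ℝ φ x y + φ x * fderiv ℝ (cutoff s n) x y := by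
        intro x
        rw [fderiv_fun_mul (hη.differentiable (by simp) x) (hφ.differentiable (by simp) x)]
        rfl
      simp only [hf] at h1
      rw [← integral_add]
      · calc _ = _ := integral_congr_ae (.of_forall fun x => by ring)
          _ = _ := h1
          _ = _ := by
            congr 1
            exact integral_congr_ae (.of_forall fun x => by ring)
      · have := hg.integrable_left hφ hc y
        refine this.bdd_mul (c := 1) hη.continuous.aestronglyMeasurable
          (.of_forall fun x => abs_cutoff_le_one s n x)
      · exact integrable_mul_testFunction hg.locallyIntegrable
          (hφ.continuous.mul (continuous_fderiv_apply_test hη y)) hc.mul_right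
    have lim := (t1.add t3)
    rw [add_zero] at lim
    exact tendsto_nhds_unique (lim.congr key) t2.neg

/-- `B` splits `u` if multiplication by the indicator function of `B` keeps `u` a radial Sobolev
function and commutes with the weak gradient. -/
structure Splits (B : Set (Space N)) (u : Space N → ℝ) : Prop where
  measurableSet : MeasurableSet B
  mem : MemH1Radial (B.indicator u)
  weakGradient_ae : weakGradient (B.indicator u) =ᵐ[volume] B.indicator (weakGradient u)

theorem MemH1Radial.splits_ball [NeZero N] {u : Space N → ℝ} (hu : MemH1Radial u) {s : ℝ}
    (hs : 0 < s) (h0 : ∀ x, ‖x‖ = s → u x = 0) : Splits (Metric.ball 0 s) u where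
  measurableSet := measurableSet_ball
  weakGradient_ae := (hu.memH1.hasWeakGradient.indicator_ball hu hs h0).weakGradient_ae
  mem :=
    { memH1 := ⟨hu.memH1.1.indicator measurableSet_ball, _,
        hu.memH1.hasWeakGradient.indicator_ball hu hs h0,
        hu.memH1.memLp_weakGradient.indicator measurableSet_ball⟩
      radial := fun x y h => by
        have : (x ∈ Metric.ball (0 : Space N) s) ↔ y ∈ Metric.ball (0 : Space N) s := by simp [h]
        by_cases hx : x ∈ Metric.ball (0 : Space N) s
        · rw [Set.indicator_of_mem hx, Set.indicator_of_mem (this.1 hx), hu.radial x y h]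
        · rw [Set.indicator_of_notMem hx, Set.indicator_of_notMem (mt this.2 hx)]
      continuousOn := by
        classical
        rw [← Set.piecewise_eq_indicator]
        refine ContinuousOn.piecewise' ?_ ?_ ?_ ?_
        · rintro a ⟨ha, ha'⟩
          rw [frontier_ball _ hs.ne'] at ha'
          have ha0 : u a = 0 := h0 a (by simpa using ha')
          have := hu.continuousOn a ha
          rw [Set.piecewise_eq_indicator, Set.indicator_apply, ha0]
          simp only [ite_self]
          have h2 : Filter.Tendsto u (nhdsWithin a {0}ᶜ) (nhds 0) := ha0 ▸ this
          exact h2.mono_left (nhdsWithin_mono _ Set.inter_subset_left)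
        · rintro a ⟨ha, ha'⟩
          rw [frontier_ball _ hs.ne'] at ha'
          have ha0 : u a = 0 := h0 a (by simpa using ha')
          rw [Set.piecewise_eq_indicator, Set.indicator_apply, ha0]
          simp only [ite_self]
          exact tendsto_const_nhds
        · exact hu.continuousOn.mono Set.inter_subset_left
        · exact continuousOn_const }

theorem MemH1Radial.splits_univ {u : Space N → ℝ} (hu : MemH1Radial u) : Splits Set.univ u where
  measurableSet := .univ
  mem := by simpa using hu
  weakGradient_ae := by simp

theorem Splits.compl {B : Set (Space N)} {u : Space N → ℝ} (h : Splits B u) (hu : MemH1Radial u) :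
    Splits Bᶜ u where
  measurableSet := h.measurableSet.compl
  mem := by
    rw [Set.indicator_compl]
    exact hu.sub h.mem
  weakGradient_ae := by
    have h1 := (hu.memH1.hasWeakGradient.add
      (h.mem.memH1.hasWeakGradient.const_smul (-1))).weakGradient_ae
    have h2 : Bᶜ.indicator u = u + (-1 : ℝ) • B.indicator u := by
      rw [Set.indicator_compl, neg_one_smul, sub_eq_add_neg]
    rw [h2]
    filter_upwards [h1, h.weakGradient_ae] with x hx hx'
    rw [hx, Set.indicator_compl]
    simp [hx', sub_eq_add_neg]

theorem Splits.inter {B B' : Set (Space N)} {u : Space N → ℝ} (h : Splits B u)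
    (h' : Splits B' (B.indicator u)) : Splits (B' ∩ B) u where
  measurableSet := h'.measurableSet.inter h.measurableSet
  mem := by
    rw [← Set.indicator_indicator]
    exact h'.mem
  weakGradient_ae := by
    rw [← Set.indicator_indicator, ← Set.indicator_indicator]
    refine h'.weakGradient_ae.trans ?_
    filter_upwards [h.weakGradient_ae] with x hx
    by_cases hx' : x ∈ B' <;> simp [hx', hx]

theorem MemH1Radial.splits_empty {u : Space N → ℝ} (hu : MemH1Radial u) : Splits ∅ u := by
  simpa using hu.splits_univ.compl hu

theorem Splits.normSq_add_compl {B : Set (Space N)} {u : Space N → ℝ} (h : Splits B u)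
    (hu : MemH1Radial u) : normSq (B.indicator u) + normSq (Bᶜ.indicator u) = normSq u := by
  have e : ∀ B : Set (Space N), Splits B u → normSq (B.indicator u) =
      ∫ x in B, (‖weakGradient u x‖ ^ 2 + u x ^ 2) := by
    intro B h
    rw [normSq, ← integral_indicator h.measurableSet]
    refine integral_congr_ae ?_
    filter_upwards [h.weakGradient_ae] with x hx
    rw [hx]
    by_cases hxB : x ∈ B <;> simp [hxB]
  rw [e B h, e Bᶜ (h.compl hu)]
  exact integral_add_compl h.measurableSet
    (hu.memH1.integrable_grad_sq.add hu.memH1.integrable_sq)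

theorem Splits.normSq_indicator_le {B : Set (Space N)} {u : Space N → ℝ} (h : Splits B u)
    (hu : MemH1Radial u) : normSq (B.indicator u) ≤ normSq u := by
  have := h.normSq_add_compl hu
  have := normSq_nonneg (Bᶜ.indicator u)
  linarith

/-! ### Pointwise and `L⁴` bounds for radial functions -/

/-- The radial field `r^{-N} ψ(r) x`, whose divergence is `r^{1-N} ψ'(r)`. -/
def radialField (N : ℕ) (ψ : ℝ → ℝ) (j : Fin N) (x : Space N) : ℝ :=
  x j * ((‖x‖ ^ N)⁻¹ * ψ ‖x‖)

theorem radialField_eventuallyEq_zero {ψ : ℝ → ℝ} {a : ℝ} (ha : 0 < a)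
    (hψa : ∀ r ≤ a, ψ r = 0) (j : Fin N) :
    radialField N ψ j =ᶠ[nhds 0] fun _ => 0 := by
  filter_upwards [Metric.ball_mem_nhds (0 : Space N) ha] with x hx
  have : ‖x‖ < a := by simpa using hx
  simp [radialField, hψa _ this.le]

theorem contDiff_radialField {ψ : ℝ → ℝ} (hψ : ContDiff ℝ ∞ ψ) {a : ℝ} (ha : 0 < a)
    (hψa : ∀ r ≤ a, ψ r = 0) (j : Fin N) : ContDiff ℝ ∞ (radialField N ψ j) := by
  rw [contDiff_iff_contDiffAt]
  intro x
  by_cases hx : x = 0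
  · subst hx
    exact contDiffAt_const.congr_of_eventuallyEq (radialField_eventuallyEq_zero ha hψa j)
  · have h1 : ContDiffAt ℝ ∞ (fun x : Space N => ‖x‖) x := contDiffAt_norm ℝ hx
    have h2 : ContDiffAt ℝ ∞ (fun x : Space N => x j) x :=
      (EuclideanSpace.proj (𝕜 := ℝ) j).contDiff.contDiffAt
    refine h2.mul (((h1.pow N).inv ?_).mul (hψ.contDiffAt.comp x h1))
    simp [hx]

theorem hasCompactSupport_radialField {ψ : ℝ → ℝ} {d : ℝ} (hψd : ∀ r ≥ d, ψ r = 0)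
    (j : Fin N) : HasCompactSupport (radialField N ψ j) := by
  refine HasCompactSupport.of_support_subset_isCompact (isCompact_closedBall (0 : Space N) d) ?_
  intro x hx
  by_contra h
  have : d < ‖x‖ := by simpa using h
  exact hx (by simp [radialField, hψd _ this.le])

theorem sum_fderiv_radialField {ψ : ℝ → ℝ} (hψ : ContDiff ℝ ∞ ψ) {x : Space N} (hx : x ≠ 0) :
    ∑ j, fderiv ℝ (radialField N ψ j) x (EuclideanSpace.single j 1) =
      ‖x‖ * (‖x‖ ^ N)⁻¹ * deriv ψ ‖x‖ := by
  have hr : 0 < ‖x‖ := norm_pos_iff.2 hx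
  have h1 : HasFDerivAt (fun x : Space N => ‖x‖) (‖x‖⁻¹ • innerSL ℝ x) x := by
    have := ((hasStrictFDerivAt_norm_sq x).hasFDerivAt).sqrt (by positivity)
    simp only [Real.sqrt_sq (norm_nonneg _)] at this
    have e : ‖x‖⁻¹ • innerSL ℝ x = (1 / (2 * ‖x‖)) • 2 • innerSL ℝ x := by
      rw [← Nat.cast_smul_eq_nsmul ℝ, smul_smul]
      congr 1
      push_cast
      field_simp
    rw [e]
    exact this
  have h2 : HasDerivAt (fun r : ℝ => (r ^ N)⁻¹ * ψ r)
      (-(N * ‖x‖ ^ (N - 1)) / (‖x‖ ^ N) ^ 2 * ψ ‖x‖ + (‖x‖ ^ N)⁻¹ * deriv ψ ‖x‖) ‖x‖ :=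
    ((hasDerivAt_pow N ‖x‖).inv (by positivity)).mul
      (hψ.differentiable (by simp) _).hasDerivAt
  have h3 := h2.comp_hasFDerivAt x h1
  have h4 : ∀ j : Fin N, fderiv ℝ (radialField N ψ j) x (EuclideanSpace.single j 1) =
      (‖x‖ ^ N)⁻¹ * ψ ‖x‖ + x j ^ 2 * ‖x‖⁻¹ *
      (-(N * ‖x‖ ^ (N - 1)) / (‖x‖ ^ N) ^ 2 * ψ ‖x‖ + (‖x‖ ^ N)⁻¹ * deriv ψ ‖x‖) := by
    intro j
    have h5 : HasFDerivAt (fun x : Space N => x j) (EuclideanSpace.proj (𝕜 := ℝ) j) x :=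
      (EuclideanSpace.proj (𝕜 := ℝ) j).hasFDerivAt
    have h6 := (h5.mul h3).fderiv
    have h7 : (fun x : Space N => x j) * ((fun r : ℝ => (r ^ N)⁻¹ * ψ r) ∘ fun x => ‖x‖) =
      radialField N ψ j := rfl
    have h8 : inner ℝ x (EuclideanSpace.single j (1 : ℝ)) = x j := by
      simp [EuclideanSpace.inner_single_right]
    rw [h7] at h6
    rw [h6]
    simp [h8]
    ring
  simp_rw [h4]
  rw [Finset.sum_add_distrib, ← Finset.sum_mul, ← Finset.sum_mul]
  have h9 : ∑ j, x j ^ 2 = ‖x‖ ^ 2 := by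
    rw [EuclideanSpace.norm_sq_eq]
    simp
  rw [← Finset.sum_mul, h9]
  simp only [Finset.sum_const, Finset.card_univ, Fintype.card_fin, nsmul_eq_mul]
  rcases N with _ | N
  · exact absurd (Subsingleton.elim x 0) hx
  · simp only [Nat.add_sub_cancel]
    field_simp
    ring

/-- The weak gradient tested with a radial field: the radial derivative is the radial component
of the gradient. -/
theorem HasWeakGradient.integral_radial {u : Space N → ℝ} {g : Space N → Space N}
    (hg : HasWeakGradient u g) [NeZero N] {ψ : ℝ → ℝ} (hψ : ContDiff ℝ ∞ ψ) {a d : ℝ} (ha : 0 < a)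
    (hψa : ∀ r ≤ a, ψ r = 0) (hψd : ∀ r ≥ d, ψ r = 0) :
    ∫ x, u x * (‖x‖ * (‖x‖ ^ N)⁻¹ * deriv ψ ‖x‖) =
      -∫ x, inner ℝ (g x) x * ((‖x‖ ^ N)⁻¹ * ψ ‖x‖) := by
  have hc := fun j => contDiff_radialField hψ ha hψa (N := N) j
  have hs := fun j => hasCompactSupport_radialField hψd (N := N) j
  have h1 : ∀ x : Space N, x ≠ 0 → u x * (‖x‖ * (‖x‖ ^ N)⁻¹ * deriv ψ ‖x‖) =
      ∑ j, u x * fderiv ℝ (radialField N ψ j) x (EuclideanSpace.single j 1) := by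
    intro x hx
    rw [← Finset.mul_sum, sum_fderiv_radialField hψ hx]
  have h2 : ∀ x : Space N, inner ℝ (g x) x * ((‖x‖ ^ N)⁻¹ * ψ ‖x‖) =
      ∑ j, inner ℝ (g x) (EuclideanSpace.single j 1) * radialField N ψ j x := by
    intro x
    simp only [radialField, ← mul_assoc]
    rw [← Finset.sum_mul, ← Finset.sum_mul]
    congr 2
    rw [PiLp.inner_apply]
    refine Finset.sum_congr rfl fun j _ => ?_
    simp [EuclideanSpace.inner_single_right, mul_comm]
  have h0 : ∀ᵐ x : Space N, x ≠ 0 := by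
    have := Measure.ae_ne (volume : Measure (Space N)) 0
    exact this
  rw [integral_congr_ae (h0.mono h1), integral_congr_ae (.of_forall h2),
    integral_finsetSum _ fun j _ => hg.integrable_left (hc j) (hs j) _,
    integral_finsetSum _ fun j _ => hg.integrable_right (hc j).continuous (hs j) _,
    ← Finset.sum_neg_distrib]
  exact Finset.sum_congr rfl fun j _ => hg.integral_eq _ (hc j) (hs j) _

/-- The volume of the unit ball of `ℝ^N`. -/
def ballVolume (N : ℕ) : ℝ := volume.real (Metric.ball (0 : Space N) 1)

theorem ballVolume_pos : 0 < ballVolume N :=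
  ENNReal.toReal_pos (Metric.measure_ball_pos _ _ one_pos).ne' measure_ball_lt_top.ne

theorem integral_fun_norm [NeZero N] (F : ℝ → ℝ) : ∫ x : Space N, F ‖x‖ =
    N * ballVolume N * ∫ r in Set.Ioi (0 : ℝ), r ^ (N - 1) * F r := by
  rw [integral_fun_norm_addHaar]
  simp [ballVolume, mul_assoc]

theorem integrable_fun_norm [NeZero N] {F : ℝ → ℝ} : Integrable (fun x : Space N => F ‖x‖) ↔
    IntegrableOn (fun r => r ^ (N - 1) * F r) (Set.Ioi 0) := by
  rw [integrable_fun_norm_addHaar]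
  simp

theorem integral_mul_le_sqrt_mul_sqrt {α : Type*} [MeasurableSpace α] {μ : Measure α}
    {f k : α → ℝ} (hf : MemLp f 2 μ) (hk : MemLp k 2 μ) :
    ∫ x, ‖f x‖ * ‖k x‖ ∂μ ≤ √(∫ x, f x ^ 2 ∂μ) * √(∫ x, k x ^ 2 ∂μ) := by
  have := integral_mul_norm_le_Lp_mul_Lq (μ := μ) (f := f) (g := k)
    (p := 2) (q := 2) Real.HolderConjugate.two_two (by simpa using hf) (by simpa using hk)
  simpa [Real.sqrt_eq_rpow] using this

theorem integral_shell [NeZero N] {a d : ℝ} (ha : 0 < a) (had : a ≤ d) :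
    Integrable ((fun r => (Set.Ioc a d).indicator (fun r => ((r ^ (N - 1))⁻¹) ^ 2) r) ∘
      fun x : Space N => ‖x‖) ∧
    ∫ x : Space N, (Set.Ioc a d).indicator (fun r => ((r ^ (N - 1))⁻¹) ^ 2) ‖x‖ =
      N * ballVolume N * ∫ r in a..d, (r ^ (N - 1))⁻¹ := by
  have e : ∀ r : ℝ, r ^ (N - 1) * (Set.Ioc a d).indicator (fun r => ((r ^ (N - 1))⁻¹) ^ 2) r =
      (Set.Ioc a d).indicator (fun r => (r ^ (N - 1))⁻¹) r := by
    intro r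
    by_cases hr : r ∈ Set.Ioc a d
    · have : 0 < r := ha.trans hr.1
      simp only [Set.indicator_of_mem hr]
      field_simp
    · simp [hr]
  have hsub : Set.Ioc a d ⊆ Set.Ioi 0 := fun r hr => ha.trans hr.1
  constructor
  · refine integrable_fun_norm.2 ?_
    simp_rw [e]
    refine Integrable.integrableOn ?_
    rw [integrable_indicator_iff measurableSet_Ioc]
    refine (ContinuousOn.integrableOn_Icc ?_).mono_set Set.Ioc_subset_Icc_self
    refine ContinuousOn.inv₀ (by fun_prop) fun r hr => ?_
    have : 0 < r := ha.trans_le hr.1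
    positivity
  · rw [integral_fun_norm]
    simp_rw [e]
    rw [setIntegral_indicator measurableSet_Ioc, Set.inter_eq_self_of_subset_right hsub,
      intervalIntegral.integral_of_le had]

theorem integral_shell_le (hN : N = 2 ∨ N = 3) {a : ℝ} (ha : 0 < a) :
    ∫ r in a..(a + 2), (r ^ (N - 1))⁻¹ ≤ 3 / √(a ^ (N - 1)) := by
  rcases hN with rfl | rfl
  · simp only [Nat.add_one_sub_one, pow_one]
    rw [integral_inv_of_pos ha (by linarith)]
    have h1 : (a + 2) / a = √(1 + 2 / a) ^ 2 := by
      rw [Real.sq_sqrt (by positivity)]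
      field_simp
    have h2 : 0 < √(1 + 2 / a) := Real.sqrt_pos.2 (by positivity)
    rw [h1, Real.log_pow]
    have h3 := Real.log_le_sub_one_of_pos h2
    have h4 : √(1 + 2 / a) ≤ 1 + 3 / 2 / √a := by
      rw [Real.sqrt_le_left (by positivity)]
      have : 0 < √a := Real.sqrt_pos.2 ha
      have hsq : √a ^ 2 = a := Real.sq_sqrt ha.le
      have h5 : 2 / a ≤ (3 / 2 / √a) ^ 2 := by
        rw [div_pow, hsq]
        gcongr
        norm_num
      nlinarith [show 0 < 3 / 2 / √a by positivity]
    have h6 : 3 / √a = 2 * (3 / 2 / √a) := by ring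
    rw [h6]
    push_cast
    linarith
  · simp only [Nat.add_one_sub_one]
    have hd : ∀ r ∈ Set.uIcc a (a + 2), HasDerivAt (fun r : ℝ => -r⁻¹) ((r ^ 2)⁻¹) r := by
      intro r hr
      rw [Set.uIcc_of_le (by linarith)] at hr
      have : r ≠ 0 := (ha.trans_le hr.1).ne'
      have h := (hasDerivAt_inv this).neg
      rw [neg_neg] at h
      exact h
    rw [intervalIntegral.integral_eq_sub_of_hasDerivAt hd]
    · rw [Real.sqrt_sq ha.le]
      have h1 : 0 < (a + 2)⁻¹ := by positivity
      have h2 : 3 / a = 3 * a⁻¹ := by ring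
      have h3 : 0 < a⁻¹ := by positivity
      linarith
    · refine ContinuousOn.intervalIntegrable ?_
      refine ContinuousOn.inv₀ (by fun_prop) fun r hr => ?_
      rw [Set.uIcc_of_le (by linarith)] at hr
      have : r ≠ 0 := (ha.trans_le hr.1).ne'
      positivity

theorem hasDerivAt_smoothStep (n : ℕ) (c r : ℝ) :
    HasDerivAt (fun r => Real.smoothTransition (n * (r - c)))
      (n * deriv Real.smoothTransition (n * (r - c))) r := by
  have h3 : HasDerivAt Real.smoothTransition (deriv Real.smoothTransition (n * (r - c)))
      (n * (r - c)) :=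
    ((Real.smoothTransition.contDiff (n := 1)).differentiable (by simp) _).hasDerivAt
  have h4 : HasDerivAt (fun r : ℝ => (n : ℝ) * (r - c)) (n * 1) r :=
    ((hasDerivAt_id r).sub_const c).const_mul _
  rw [mul_one] at h4
  rw [mul_comm]
  exact h3.comp r h4

/-- The derivatives of steeper and steeper smooth steps at `c` are an approximate identity. -/
theorem tendsto_integral_smoothStep {f : ℝ → ℝ} {a c d : ℝ} (hac : a ≤ c) (hcd : c + 1 ≤ d)
    (hf : ContinuousOn f (Set.Icc a d)) :
    Filter.Tendsto (fun n : ℕ => ∫ r in a..d, f r * (n * deriv Real.smoothTransition (n * (r - c))))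
      Filter.atTop (nhds (f c)) := by
  have hc : c ∈ Set.Icc a d := ⟨hac, by linarith⟩
  have had : a ≤ d := by linarith
  rw [Metric.tendsto_atTop]
  intro ε hε
  obtain ⟨δ, hδ, h⟩ := Metric.continuousWithinAt_iff.1 (hf c hc) (ε / 2) (by positivity)
  obtain ⟨n₀, hn₀⟩ := exists_nat_gt (1 / δ)
  refine ⟨max n₀ 1, fun n hn => ?_⟩
  have hn1 : (1 : ℝ) ≤ n := by exact_mod_cast (le_max_right _ _).trans hn
  have hn2 : (n₀ : ℝ) ≤ n := by exact_mod_cast (le_max_left _ _).trans hn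
  have hnδ : 1 < n * δ := by
    rw [div_lt_iff₀ hδ] at hn₀
    nlinarith
  set D : ℝ → ℝ := fun r => n * deriv Real.smoothTransition (n * (r - c)) with hD
  have hDc : Continuous D := by
    refine continuous_const.mul (continuous_deriv_smoothTransition.comp ?_)
    fun_prop
  have hD0 : ∀ r, 0 ≤ D r := fun r =>
    mul_nonneg (by positivity) (Real.smoothTransition.monotone.deriv_nonneg)
  have hint : ∫ r in a..d, D r = 1 := by
    rw [intervalIntegral.integral_eq_sub_of_hasDerivAt (fun r _ => hasDerivAt_smoothStep n c r)
      (hDc.intervalIntegrable _ _)]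
    rw [Real.smoothTransition.one_of_one_le, Real.smoothTransition.zero_of_nonpos, sub_zero]
    · exact mul_nonpos_of_nonneg_of_nonpos (by positivity) (by linarith)
    · nlinarith
  have i1 : IntervalIntegrable (fun r => f r * D r) volume a d := by
    refine ContinuousOn.intervalIntegrable ?_
    rw [Set.uIcc_of_le had]
    exact hf.mul hDc.continuousOn
  have i2 : IntervalIntegrable (fun r => f c * D r) volume a d :=
    (continuous_const.mul hDc).intervalIntegrable _ _
  have e1 : (∫ r in a..d, f r * D r) - f c = ∫ r in a..d, (f r * D r - f c * D r) := by
    rw [intervalIntegral.integral_sub i1 i2, intervalIntegral.integral_const_mul, hint, mul_one]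
  rw [Real.dist_eq, e1]
  have hb : ∀ r ∈ Set.Icc a d, |f r * D r - f c * D r| ≤ ε / 2 * D r := by
    intro r hr
    rw [← sub_mul, abs_mul, abs_of_nonneg (hD0 r)]
    by_cases hr1 : r ≤ c
    · have : D r = 0 := by
        simp only [hD]
        rw [deriv_smoothTransition_of_nonpos, mul_zero]
        exact mul_nonpos_of_nonneg_of_nonpos (by positivity) (by linarith)
      simp [this]
    by_cases hr2 : 1 ≤ n * (r - c)
    · have : D r = 0 := by
        simp only [hD]
        rw [deriv_smoothTransition_of_one_le hr2, mul_zero]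
      simp [this]
    · have hrc : dist r c < δ := by
        rw [Real.dist_eq, abs_of_pos (by linarith)]
        by_contra hcon
        have : (n : ℝ) * δ ≤ n * (r - c) := by
          refine mul_le_mul_of_nonneg_left (by linarith) (by positivity)
        linarith
      have := h hr hrc
      rw [Real.dist_eq] at this
      exact mul_le_mul_of_nonneg_right this.le (hD0 r)
  calc |∫ r in a..d, (f r * D r - f c * D r)|
      ≤ ∫ r in a..d, |f r * D r - f c * D r| :=
        intervalIntegral.abs_integral_le_integral_abs had
    _ ≤ ∫ r in a..d, ε / 2 * D r :=
        intervalIntegral.integral_mono_on had (i1.sub i2).abs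
          ((continuous_const.mul hDc).intervalIntegrable _ _) hb
    _ = ε / 2 := by rw [intervalIntegral.integral_const_mul, hint, mul_one]
    _ < ε := by linarith

/-- The Cauchy-Schwarz bound for the radial derivative tested with `ψ`. -/
theorem abs_integral_profile_mul_deriv_le [NeZero N] (hN : N = 2 ∨ N = 3) {u : Space N → ℝ}
    (hu : MemH1Radial u) {ψ : ℝ → ℝ} (hψ : ContDiff ℝ ∞ ψ) {a : ℝ} (ha : 0 < a)
    (hψa : ∀ r ≤ a, ψ r = 0) (hψd : ∀ r ≥ a + 2, ψ r = 0) (hψ1 : ∀ r, |ψ r| ≤ 1) :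
    |N * ballVolume N * ∫ r in a..(a + 2), profile u r * deriv ψ r| ≤
      √(∫ x, ‖weakGradient u x‖ ^ 2) * √(N * ballVolume N * (3 / √(a ^ (N - 1)))) := by
  have hβ := ballVolume_pos (N := N)
  have hzero : ∀ r, r ∉ Set.Ioc a (a + 2) → deriv ψ r = 0 := by
    intro r hr
    have hcl : IsClosed {t | deriv ψ t = 0} :=
      isClosed_eq (hψ.continuous_deriv (by simp)) continuous_const
    rw [Set.mem_Ioc, not_and_or, not_lt, not_le] at hr
    rcases hr with hr | hr
    · have h1 : Set.Iio a ⊆ {t | deriv ψ t = 0} := fun t ht => by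
        have : ψ =ᶠ[nhds t] fun _ => 0 := by
          filter_upwards [gt_mem_nhds (Set.mem_Iio.1 ht)] with x hx
          exact hψa x hx.le
        simp [this.deriv_eq]
      have h2 := hcl.closure_subset_iff.2 h1
      rw [closure_Iio] at h2
      exact h2 hr
    · have : ψ =ᶠ[nhds r] fun _ => 0 := by
        filter_upwards [lt_mem_nhds hr] with x hx
        exact hψd x hx.le
      simp [this.deriv_eq]
  have e1 := hu.memH1.hasWeakGradient.integral_radial hψ ha hψa hψd
  have e2 : ∫ x, u x * (‖x‖ * (‖x‖ ^ N)⁻¹ * deriv ψ ‖x‖) =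
      N * ballVolume N * ∫ r in a..(a + 2), profile u r * deriv ψ r := by
    have : ∀ x, u x * (‖x‖ * (‖x‖ ^ N)⁻¹ * deriv ψ ‖x‖) =
        (fun r => profile u r * (r * (r ^ N)⁻¹ * deriv ψ r)) ‖x‖ := by
      intro x
      simp only [← hu.eq_profile]
    rw [integral_congr_ae (.of_forall this)]
    rw [integral_fun_norm (fun r => profile u r * (r * (r ^ N)⁻¹ * deriv ψ r)),
      intervalIntegral.integral_of_le (by linarith)]
    congr 1
    rw [← setIntegral_eq_of_subset_of_forall_sdiff_eq_zero (s := Set.Ioc a (a + 2))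
      (t := Set.Ioi 0) measurableSet_Ioi (fun r hr => ha.trans hr.1)]
    · refine setIntegral_congr_fun measurableSet_Ioi fun r hr => ?_
      have : 0 < r := hr
      have := pow_sub_one_mul (NeZero.ne N) r
      simp only [← this]
      field_simp
    · intro r hr
      simp [hzero r hr.2]
  rw [← e2, e1, abs_neg]
  obtain ⟨s1, s2⟩ := integral_shell (N := N) ha (show a ≤ a + 2 by linarith)
  set k : Space N → ℝ := fun x => (Set.Ioc a (a + 2)).indicator (fun r => (r ^ (N - 1))⁻¹) ‖x‖
    with hk
  have hk2 : ∀ x, k x ^ 2 = (Set.Ioc a (a + 2)).indicator (fun r => ((r ^ (N - 1))⁻¹) ^ 2) ‖x‖ := by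
    intro x
    by_cases hx : ‖x‖ ∈ Set.Ioc a (a + 2) <;> simp [hk, hx]
  have hkm : Measurable k := by
    have : Measurable fun r : ℝ => (Set.Ioc a (a + 2)).indicator (fun r => (r ^ (N - 1))⁻¹) r :=
      Measurable.indicator (by fun_prop) measurableSet_Ioc
    exact this.comp measurable_norm
  have hkL : MemLp k 2 volume := by
    rw [memLp_two_iff_integrable_sq hkm.aestronglyMeasurable]
    simp_rw [hk2]
    exact s1
  have hgL : MemLp (fun x => ‖weakGradient u x‖) 2 volume := hu.memH1.memLp_weakGradient.norm
  have hgk : Integrable fun x => ‖‖weakGradient u x‖‖ * ‖k x‖ :=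
    (hgL.norm.integrable_mul hkL.norm)
  calc ‖∫ x, inner ℝ (weakGradient u x) x * ((‖x‖ ^ N)⁻¹ * ψ ‖x‖)‖
      ≤ ∫ x, ‖‖weakGradient u x‖‖ * ‖k x‖ := by
        refine norm_integral_le_of_norm_le hgk (.of_forall fun x => ?_)
        by_cases hx : ‖x‖ ∈ Set.Ioc a (a + 2)
        · have hr : 0 < ‖x‖ := ha.trans hx.1
          have hkx : ‖k x‖ = (‖x‖ ^ (N - 1))⁻¹ := by
            simp only [hk]
            rw [Set.indicator_of_mem hx, Real.norm_eq_abs, abs_of_pos (by positivity)]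
          rw [norm_norm, hkx, norm_mul, norm_mul, norm_inv, norm_pow, norm_norm]
          calc ‖inner ℝ (weakGradient u x) x‖ * ((‖x‖ ^ N)⁻¹ * ‖ψ ‖x‖‖)
              ≤ (‖weakGradient u x‖ * ‖x‖) * ((‖x‖ ^ N)⁻¹ * 1) := by
                gcongr
                · exact norm_inner_le_norm _ _
                · exact hψ1 _
            _ = ‖weakGradient u x‖ * (‖x‖ ^ (N - 1))⁻¹ := by
                rw [← pow_sub_one_mul (NeZero.ne N) ‖x‖]
                field_simp
        · have : ψ ‖x‖ = 0 := by
            rw [Set.mem_Ioc, not_and_or, not_lt, not_le] at hx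
            exact hx.elim (hψa _) fun h => hψd _ h.le
          rw [this]
          simp only [mul_zero, norm_zero]
          positivity
    _ ≤ √(∫ x, ‖weakGradient u x‖ ^ 2) * √(∫ x, k x ^ 2) := integral_mul_le_sqrt_mul_sqrt hgL hkL
    _ ≤ _ := by
        gcongr
        simp_rw [hk2]
        rw [s2]
        gcongr
        exact integral_shell_le hN ha

/-- The oscillation of a radial function over radii `a ≤ b ≤ a + 1` is controlled by its Dirichlet
integral: its gradient is tested with the radial field of a smoothed indicator function of
`[a, b]`. -/
theorem abs_profile_sub_profile_le [NeZero N] (hN : N = 2 ∨ N = 3) {u : Space N → ℝ}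
    (hu : MemH1Radial u) {a b : ℝ} (ha : 0 < a) (hab : a ≤ b) (hb : b ≤ a + 1) :
    |N * ballVolume N * (profile u a - profile u b)| ≤
      √(∫ x, ‖weakGradient u x‖ ^ 2) * √(N * ballVolume N * (3 / √(a ^ (N - 1)))) := by
  have hc : ContinuousOn (profile u) (Set.Icc a (a + 2)) :=
    hu.continuousOn_profile.mono fun r hr => ha.trans_le hr.1
  have t1 := tendsto_integral_smoothStep (c := a) le_rfl (by linarith) hc
  have t2 := tendsto_integral_smoothStep (c := b) hab (by linarith) hc
  refine le_of_tendsto ((t1.sub t2).const_mul (N * ballVolume N)).abs ?_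
  filter_upwards [Filter.eventually_ge_atTop 1] with n hn
  have hn1 : (1 : ℝ) ≤ n := by exact_mod_cast hn
  set ψ : ℝ → ℝ := fun r =>
    Real.smoothTransition (n * (r - a)) - Real.smoothTransition (n * (r - b)) with hψ
  have hstep : ∀ c : ℝ, ContDiff ℝ ∞ fun r => Real.smoothTransition (n * (r - c)) := fun c =>
    (Real.smoothTransition.contDiff (n := ⊤)).comp
      (contDiff_const.mul (contDiff_id.sub contDiff_const))
  have hψc : ContDiff ℝ ∞ ψ := (hstep a).sub (hstep b)
  have hd : ∀ r, deriv ψ r = n * deriv Real.smoothTransition (n * (r - a)) -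
      n * deriv Real.smoothTransition (n * (r - b)) := fun r =>
    ((hasDerivAt_smoothStep n a r).sub (hasDerivAt_smoothStep n b r)).deriv
  have key := abs_integral_profile_mul_deriv_le hN hu hψc ha ?_ ?_ ?_
  · refine le_of_eq_of_le ?_ key
    congr 2
    rw [← intervalIntegral.integral_sub]
    · refine intervalIntegral.integral_congr fun r _ => ?_
      simp only [hd]
      ring
    all_goals
      refine ContinuousOn.intervalIntegrable ?_
      rw [Set.uIcc_of_le (by linarith)]
      refine hc.mul (Continuous.continuousOn ?_)
      exact continuous_const.mul (continuous_deriv_smoothTransition.comp (by fun_prop))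
  · intro r hr
    simp only [hψ]
    rw [Real.smoothTransition.zero_of_nonpos, Real.smoothTransition.zero_of_nonpos, sub_zero]
    · exact mul_nonpos_of_nonneg_of_nonpos (by positivity) (by linarith)
    · exact mul_nonpos_of_nonneg_of_nonpos (by positivity) (by linarith)
  · intro r hr
    simp only [hψ]
    rw [Real.smoothTransition.one_of_one_le, Real.smoothTransition.one_of_one_le, sub_self]
    · nlinarith
    · nlinarith
  · intro r
    simp only [hψ]
    have h1 := Real.smoothTransition.nonneg (n * (r - a))
    have h2 := Real.smoothTransition.nonneg (n * (r - b))
    have h3 := Real.smoothTransition.le_one (n * (r - a))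
    have h4 := Real.smoothTransition.le_one (n * (r - b))
    rw [abs_le]
    constructor <;> linarith

/-- The weight `1 + r^{-(N-1)/2}` of the radial lemma. For `N = 2, 3` its square is integrable at
the origin, which gives the embedding into `L⁴`; no decay at infinity is recorded. -/
def weight (N : ℕ) (r : ℝ) : ℝ := 1 + 1 / √(r ^ (N - 1))

theorem weight_pos (N : ℕ) (r : ℝ) : 0 < weight N r := by
  unfold weight
  positivity

/-- The radial lemma: `|u(x)|² ≤ C (1 + |x|^{-(N-1)/2}) ‖u‖²`. -/
theorem exists_sq_le_weight_mul_normSq (hN : N = 2 ∨ N = 3) :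
    ∃ C : ℝ, 0 < C ∧ ∀ u : Space N → ℝ, MemH1Radial u → ∀ x, x ≠ 0 →
      u x ^ 2 ≤ C * weight N ‖x‖ * normSq u := by
  have : NeZero N := ⟨by omega⟩
  have hβ := ballVolume_pos (N := N)
  have hN1 : (1 : ℝ) ≤ N := by exact_mod_cast NeZero.one_le
  refine ⟨8 / ballVolume N, by positivity, fun u hu x hx => ?_⟩
  set a := ‖x‖ with ha'
  have ha : 0 < a := norm_pos_iff.2 hx
  set G := ∫ x, ‖weakGradient u x‖ ^ 2 with hG
  set U := ∫ x, u x ^ 2 with hU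
  have hG0 : 0 ≤ G := integral_nonneg fun x => by positivity
  have hU0 : 0 ≤ U := integral_nonneg fun x => by positivity
  have hn : normSq u = U + G := hu.memH1.normSq_eq
  set q := 1 / √(a ^ (N - 1)) with hq
  have hq0 : 0 < q := by positivity
  set β := ballVolume N with hβdef
  clear_value a G U q β
  set M := √(3 * q * G / β) with hM
  have hM0 : 0 ≤ M := Real.sqrt_nonneg _
  have hM2 : M ^ 2 = 3 * q * G / β := by rw [hM, Real.sq_sqrt (by positivity)]
  clear_value M
  have hdiff : ∀ b, a ≤ b → b ≤ a + 1 → |profile u a - profile u b| ≤ M := by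
    intro b hab hb
    have := abs_profile_sub_profile_le hN hu ha hab hb
    rw [← hG, ← hβdef, ← Real.sqrt_mul hG0, abs_mul,
      abs_of_pos (by positivity : 0 < (N : ℝ) * β)] at this
    have h3 : 0 < (N : ℝ) * β := by positivity
    rw [hM]
    refine Real.le_sqrt_of_sq_le ?_
    have h4 : (N * β * |profile u a - profile u b|) ^ 2 ≤ G * (N * β * (3 * q)) := by
      refine (Real.le_sqrt (by positivity) (by positivity)).1 ?_
      rw [show 3 * q = 3 / √(a ^ (N - 1)) by rw [hq]; ring]
      exact this
    set D := |profile u a - profile u b| with hD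
    have hD2 : 0 ≤ D ^ 2 := by positivity
    rw [le_div_iff₀ hβ]
    have h5 : (N * β) * (N * β * D ^ 2) ≤ (N * β) * (3 * q * G) := by nlinarith
    have h6 := le_of_mul_le_mul_left h5 h3
    have h7 : β * D ^ 2 ≤ N * (β * D ^ 2) := le_mul_of_one_le_left (by positivity) hN1
    linarith
  have hmain : u x ^ 2 ≤ 2 * M ^ 2 + 2 * (U / β) := by
    by_cases hcase : |u x| ≤ M
    · have : u x ^ 2 ≤ M ^ 2 :=
        sq_le_sq' (by linarith [neg_abs_le (u x)]) ((le_abs_self _).trans hcase)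
      have : 0 ≤ U / β := by positivity
      nlinarith
    · push Not at hcase
      -- `|u|` exceeds `e` on a shell whose volume is at least that of the unit ball
      set e := |u x| - M with he
      have he0 : 0 < e := by linarith
      set S := Metric.ball (0 : Space N) (a + 1) \ Metric.ball 0 a with hS
      have hSm : MeasurableSet S := measurableSet_ball.diff measurableSet_ball
      have hSu : ∀ z ∈ S, e ^ 2 ≤ u z ^ 2 := by
        intro z hz
        have hz1 : ‖z‖ < a + 1 := by simpa using hz.1
        have hz2 : a ≤ ‖z‖ := by simpa using hz.2
        have h1 := hdiff ‖z‖ hz2 hz1.le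
        rw [← hu.eq_profile z, ha', ← hu.eq_profile x] at h1
        have h2 : |u x| - |u z| ≤ |u x - u z| := abs_sub_abs_le_abs_sub _ _
        have h3 : e ≤ |u z| := by linarith
        calc e ^ 2 ≤ |u z| ^ 2 := by gcongr
          _ = u z ^ 2 := sq_abs _
      have hSfin : volume S ≠ ⊤ :=
        ((measure_mono Set.sdiff_subset).trans_lt measure_ball_lt_top).ne
      have hvol : β ≤ volume.real S := by
        have hb : ∀ r : ℝ, 0 ≤ r → volume.real (Metric.ball (0 : Space N) r) = r ^ N * β := by
          intro r hr
          rw [measureReal_def, Measure.addHaar_ball _ _ hr, ENNReal.toReal_mul,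
            ENNReal.toReal_ofReal (by positivity), hβdef, ballVolume, measureReal_def]
          simp
        rw [measureReal_sdiff (Metric.ball_subset_ball (by linarith)) measurableSet_ball,
          hb _ ha.le, hb _ (by linarith)]
        have : a ^ N + 1 ^ N ≤ (a + 1) ^ N := pow_add_pow_le ha.le zero_le_one (NeZero.ne N)
        rw [one_pow] at this
        nlinarith
      have h1 : e ^ 2 * volume.real S ≤ U := by
        calc e ^ 2 * volume.real S = ∫ z in S, e ^ 2 := by
              rw [setIntegral_const, smul_eq_mul, mul_comm]
          _ ≤ ∫ z in S, u z ^ 2 :=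
              setIntegral_mono_on (integrableOn_const hSfin) hu.memH1.integrable_sq.integrableOn
                hSm hSu
          _ ≤ U := hU ▸
              setIntegral_le_integral hu.memH1.integrable_sq (.of_forall fun z => sq_nonneg _)
      have h2 : e ^ 2 ≤ U / β := by
        rw [le_div_iff₀ hβ]
        have : 0 ≤ e ^ 2 := sq_nonneg e
        nlinarith
      have h3 : u x ^ 2 = (e + M) ^ 2 := by rw [he, sub_add_cancel, sq_abs]
      rw [h3]
      nlinarith [sq_nonneg (e - M)]
  calc u x ^ 2 ≤ 2 * M ^ 2 + 2 * (U / β) := hmain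
    _ = 1 / β * (6 * q * G + 2 * U) := by rw [hM2]; ring
    _ ≤ 1 / β * (8 * ((1 + q) * (U + G))) := by
        gcongr
        nlinarith [mul_nonneg hq0.le hU0, mul_nonneg hq0.le hG0]
    _ = _ := by rw [hn, weight, ← hq]; ring

theorem integrable_ball_inv_norm_pow [NeZero N] :
    Integrable fun x : Space N => (Set.Iio (1 : ℝ)).indicator (fun r => (r ^ (N - 1))⁻¹) ‖x‖ := by
  refine integrable_fun_norm.2 ?_
  have h1 : IntegrableOn ((Set.Ioo (0 : ℝ) 1).indicator fun _ => (1 : ℝ)) (Set.Ioi 0) := by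
    refine Integrable.integrableOn ?_
    rw [integrable_indicator_iff measurableSet_Ioo]
    exact integrableOn_const (by simp)
  refine h1.congr_fun (fun r hr => ?_) measurableSet_Ioi
  have hr0 : 0 < r := hr
  by_cases h : r < 1
  · simp [h, hr0, hr0.ne']
  · simp [h]

/-- A radial function with `u² ≤ S · weight` pointwise satisfies `∫ u⁴ ≤ C S ‖u‖²`. -/
theorem exists_integral_pow_four_le (hN : N = 2 ∨ N = 3) :
    ∃ C : ℝ, 0 < C ∧ ∀ u : Space N → ℝ, MemH1Radial u → ∀ S : ℝ, 0 ≤ S →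
      (∀ x, x ≠ 0 → u x ^ 2 ≤ S * weight N ‖x‖) →
      Integrable (fun x => u x ^ 4) ∧ ∫ x, u x ^ 4 ≤ S * C * normSq u := by
  have : NeZero N := ⟨by omega⟩
  obtain ⟨C, hC, hCu⟩ := exists_sq_le_weight_mul_normSq hN
  set k : Space N → ℝ := fun x => (Set.Iio (1 : ℝ)).indicator (fun r => (r ^ (N - 1))⁻¹) ‖x‖ with hk
  have hki : Integrable k := integrable_ball_inv_norm_pow
  have hk0 : ∀ x, 0 ≤ k x := fun x => by
    by_cases hx : ‖x‖ < 1 <;> simp [hk, hx]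
  have hZ : 0 ≤ ∫ x, k x := integral_nonneg hk0
  refine ⟨2 + 4 * C * ∫ x, k x, by positivity, fun u hu S hS hSu => ?_⟩
  have hn := normSq_nonneg u
  have hpt : ∀ x, x ≠ 0 → u x ^ 4 ≤ S * (2 * u x ^ 2 + 4 * C * normSq u * k x) := by
    intro x hx
    have hr : 0 < ‖x‖ := norm_pos_iff.2 hx
    have h1 : weight N ‖x‖ * u x ^ 2 ≤ 2 * u x ^ 2 + 4 * C * normSq u * k x := by
      by_cases hx1 : ‖x‖ < 1
      · have hkx : k x = (‖x‖ ^ (N - 1))⁻¹ := by simp [hk, hx1]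
        have hp : ‖x‖ ^ (N - 1) ≤ 1 := pow_le_one₀ hr.le hx1.le
        have hp0 : 0 < ‖x‖ ^ (N - 1) := by positivity
        have hw : weight N ‖x‖ ^ 2 ≤ 4 * k x := by
          rw [hkx, weight]
          set s := √(‖x‖ ^ (N - 1)) with hs
          have hs0 : 0 < s := Real.sqrt_pos.2 hp0
          have hs1 : s ≤ 1 := Real.sqrt_le_one.2 hp
          have hs2 : ‖x‖ ^ (N - 1) = s ^ 2 := (Real.sq_sqrt hp0.le).symm
          rw [hs2]
          have h2 : 1 ≤ 1 / s := by rwa [one_le_div hs0]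
          have h3 : (s ^ 2)⁻¹ = (1 / s) ^ 2 := by simp
          rw [h3]
          nlinarith
        have h2 := hCu u hu x hx
        have hw0 := weight_pos N ‖x‖
        calc weight N ‖x‖ * u x ^ 2 ≤ weight N ‖x‖ * (C * weight N ‖x‖ * normSq u) := by gcongr
          _ = C * normSq u * weight N ‖x‖ ^ 2 := by ring
          _ ≤ C * normSq u * (4 * k x) := by gcongr
          _ ≤ _ := by nlinarith [sq_nonneg (u x)]
      · have hw : weight N ‖x‖ ≤ 2 := by
          rw [weight]
          have : 1 ≤ √(‖x‖ ^ (N - 1)) := Real.one_le_sqrt.2 (one_le_pow₀ (not_lt.1 hx1))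
          have : 1 / √(‖x‖ ^ (N - 1)) ≤ 1 := by
            rw [div_le_one (by linarith)]
            exact this
          linarith
        have : 0 ≤ 4 * C * normSq u * k x := by
          have := hk0 x
          positivity
        nlinarith [sq_nonneg (u x)]
    calc u x ^ 4 = u x ^ 2 * u x ^ 2 := by ring
      _ ≤ S * weight N ‖x‖ * u x ^ 2 := by gcongr; exact hSu x hx
      _ = S * (weight N ‖x‖ * u x ^ 2) := by ring
      _ ≤ _ := by gcongr
  have h0 : ∀ᵐ x : Space N, x ≠ 0 := Measure.ae_ne (volume : Measure (Space N)) 0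
  have hi : Integrable fun x => S * (2 * u x ^ 2 + 4 * C * normSq u * k x) :=
    ((hu.memH1.integrable_sq.const_mul 2).add (hki.const_mul _)).const_mul S
  have hi4 : Integrable fun x => u x ^ 4 := by
    refine hi.mono' (hu.memH1.1.1.pow 4) (h0.mono fun x hx => ?_)
    rw [Real.norm_eq_abs, abs_of_nonneg (by positivity)]
    exact hpt x hx
  refine ⟨hi4, ?_⟩
  calc ∫ x, u x ^ 4 ≤ ∫ x, S * (2 * u x ^ 2 + 4 * C * normSq u * k x) :=
        integral_mono_ae hi4 hi (h0.mono hpt)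
    _ = S * (2 * (∫ x, u x ^ 2) + 4 * C * normSq u * ∫ x, k x) := by
        rw [integral_const_mul, integral_add (hu.memH1.integrable_sq.const_mul 2)
          (hki.const_mul _), integral_const_mul, integral_const_mul]
    _ ≤ S * (2 * normSq u + 4 * C * normSq u * ∫ x, k x) := by
        gcongr
        rw [hu.memH1.normSq_eq]
        have : 0 ≤ ∫ x, ‖weakGradient u x‖ ^ 2 := integral_nonneg fun x => by positivity
        linarith
    _ = _ := by ring

variable {h : ℕ}

/-! ### Quartic integrals -/

/-- The norm of `H¹(ℝ^N)`. -/
def h1Norm (u : Space N → ℝ) : ℝ := √(normSq u)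

theorem h1Norm_nonneg (u : Space N → ℝ) : 0 ≤ h1Norm u := Real.sqrt_nonneg _

theorem h1Norm_sq (u : Space N → ℝ) : h1Norm u ^ 2 = normSq u := Real.sq_sqrt (normSq_nonneg u)

theorem h1Norm_add_le {u v : Space N → ℝ} (hu : MemH1Radial u) (hv : MemH1Radial v) :
    h1Norm (u + v) ≤ h1Norm u + h1Norm v := sqrt_normSq_add_le hu hv

theorem h1Norm_neg {u : Space N → ℝ} (hu : MemH1Radial u) : h1Norm (-u) = h1Norm u := by
  rw [h1Norm, h1Norm, ← neg_one_smul ℝ u, normSq_smul hu]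
  simp

theorem h1Norm_sub_comm {u v : Space N → ℝ} (hu : MemH1Radial u) (hv : MemH1Radial v) :
    h1Norm (u - v) = h1Norm (v - u) := by
  rw [← neg_sub, h1Norm_neg (hv.sub hu)]

theorem h1Norm_le_add {u v : Space N → ℝ} (hu : MemH1Radial u) (hv : MemH1Radial v) :
    h1Norm u ≤ h1Norm v + h1Norm (u - v) := by
  have := h1Norm_add_le hv (hu.sub hv)
  rwa [add_sub_cancel] at this

theorem h1Norm_le_of_normSq_le {u v : Space N → ℝ} (h : normSq u ≤ normSq v) : h1Norm u ≤ h1Norm v :=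
  Real.sqrt_le_sqrt h

/-- The Sobolev embedding of the radial functions into `L⁴`. -/
theorem exists_sobolev (hN : N = 2 ∨ N = 3) :
    ∃ C : ℝ, 0 < C ∧ ∀ u : Space N → ℝ, MemH1Radial u →
      Integrable (fun x => u x ^ 4) ∧ ∫ x, u x ^ 4 ≤ C * normSq u ^ 2 := by
  obtain ⟨C₁, hC₁, h₁⟩ := exists_sq_le_weight_mul_normSq hN
  obtain ⟨C₂, hC₂, h₂⟩ := exists_integral_pow_four_le hN
  refine ⟨C₁ * C₂, by positivity, fun u hu => ?_⟩
  have hn := normSq_nonneg u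
  obtain ⟨hi, hle⟩ := h₂ u hu (C₁ * normSq u) (by positivity) fun x hx => by
    have := h₁ u hu x hx
    linarith
  exact ⟨hi, hle.trans_eq (by ring)⟩

theorem integrable_pow_four (hN : N = 2 ∨ N = 3) {u : Space N → ℝ} (hu : MemH1Radial u) :
    Integrable (fun x => u x ^ 4) := by
  obtain ⟨_, _, h⟩ := exists_sobolev hN
  exact (h u hu).1

theorem memLp_sq (hN : N = 2 ∨ N = 3) {u : Space N → ℝ} (hu : MemH1Radial u) :
    MemLp (fun x => u x ^ 2) 2 volume := by
  refine (memLp_two_iff_integrable_sq (hu.memH1.1.1.pow 2)).2 ?_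
  simpa [← pow_mul] using integrable_pow_four hN hu

theorem memLp_mul (hN : N = 2 ∨ N = 3) {a b : Space N → ℝ} (ha : MemH1Radial a)
    (hb : MemH1Radial b) : MemLp (fun x => a x * b x) 2 volume := by
  refine (memLp_two_iff_integrable_sq (ha.memH1.1.1.mul hb.memH1.1.1)).2 ?_
  have := (memLp_sq hN ha).integrable_mul (memLp_sq hN hb)
  refine this.congr (.of_forall fun x => ?_)
  simp [mul_pow]

theorem integrable_mul_four (hN : N = 2 ∨ N = 3) {a b c d : Space N → ℝ} (ha : MemH1Radial a)
    (hb : MemH1Radial b) (hc : MemH1Radial c) (hd : MemH1Radial d) :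
    Integrable fun x => a x * b x * (c x * d x) :=
  (memLp_mul hN ha hb).integrable_mul (memLp_mul hN hc hd)

/-- The quadrilinear form `∫ a b c d` is bounded on the radial Sobolev functions. -/
theorem exists_abs_integral_mul_four_le (hN : N = 2 ∨ N = 3) :
    ∃ C : ℝ, 0 < C ∧ ∀ a b c d : Space N → ℝ, MemH1Radial a → MemH1Radial b → MemH1Radial c →
      MemH1Radial d →
      |∫ x, a x * b x * (c x * d x)| ≤ C * (h1Norm a * h1Norm b * (h1Norm c * h1Norm d)) := by
  obtain ⟨C, hC, hS⟩ := exists_sobolev hN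
  have h2 : ∀ a b : Space N → ℝ, MemH1Radial a → MemH1Radial b →
      √(∫ x, (a x * b x) ^ 2) ≤ √C * (h1Norm a * h1Norm b) := by
    intro a b ha hb
    have e1 : ∫ x, (a x * b x) ^ 2 = ∫ x, ‖a x ^ 2‖ * ‖b x ^ 2‖ :=
      integral_congr_ae (.of_forall fun x => by
        simp only [mul_pow, norm_pow, Real.norm_eq_abs, sq_abs])
    have h3 := integral_mul_le_sqrt_mul_sqrt (memLp_sq hN ha) (memLp_sq hN hb)
    have h4 : ∀ a : Space N → ℝ, MemH1Radial a → √(∫ x, (a x ^ 2) ^ 2) ≤ √C * normSq a := by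
      intro a ha
      have := (hS a ha).2
      simp_rw [← pow_mul]
      rw [Real.sqrt_le_left (by have := normSq_nonneg a; positivity), mul_pow, Real.sq_sqrt hC.le]
      exact this
    refine Real.sqrt_le_iff.2 ⟨by have := h1Norm_nonneg a; have := h1Norm_nonneg b; positivity, ?_⟩
    rw [e1]
    calc _ ≤ _ := h3
      _ ≤ (√C * normSq a) * (√C * normSq b) := by
        have := normSq_nonneg a
        gcongr
        · exact h4 a ha
        · exact h4 b hb
      _ = _ := by rw [← h1Norm_sq, ← h1Norm_sq]; ring
  refine ⟨C, hC, fun a b c d ha hb hc hd => ?_⟩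
  have h5 := integral_mul_le_sqrt_mul_sqrt (memLp_mul hN ha hb) (memLp_mul hN hc hd)
  have h6 : |∫ x, a x * b x * (c x * d x)| ≤ ∫ x, ‖a x * b x‖ * ‖c x * d x‖ := by
    refine (norm_integral_le_integral_norm (fun x => a x * b x * (c x * d x))).trans_eq ?_
    exact integral_congr_ae (.of_forall fun x => norm_mul _ _)
  calc _ ≤ _ := h6
    _ ≤ _ := h5
    _ ≤ (√C * (h1Norm a * h1Norm b)) * (√C * (h1Norm c * h1Norm d)) := by
        have := h1Norm_nonneg a
        have := h1Norm_nonneg b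
        gcongr
        · exact h2 a b ha hb
        · exact h2 c d hc hd
    _ = √C ^ 2 * (h1Norm a * h1Norm b * (h1Norm c * h1Norm d)) := by ring
    _ = _ := by rw [Real.sq_sqrt hC.le]

theorem exists_abs_integral_pow_four_sub_le (hN : N = 2 ∨ N = 3) :
    ∃ C : ℝ, 0 < C ∧ ∀ (R : ℝ) (u v : Space N → ℝ), MemH1Radial u → MemH1Radial v →
      h1Norm u ≤ R → h1Norm v ≤ R →
      |(∫ x, u x ^ 4) - ∫ x, v x ^ 4| ≤ C * R ^ 3 * h1Norm (u - v) := by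
  obtain ⟨C, hC, hT⟩ := exists_abs_integral_mul_four_le hN
  refine ⟨4 * C, by positivity, fun R u v hu hv huR hvR => ?_⟩
  have i1 := integrable_mul_four hN (hu.sub hv) (hu.add hv) hu hu
  have i2 := integrable_mul_four hN (hu.sub hv) (hu.add hv) hv hv
  have e : (∫ x, u x ^ 4) - ∫ x, v x ^ 4 = (∫ x, (u - v) x * (u + v) x * (u x * u x)) +
      ∫ x, (u - v) x * (u + v) x * (v x * v x) := by
    rw [← integral_sub (integrable_pow_four hN hu) (integrable_pow_four hN hv),
      ← integral_add i1 i2]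
    refine integral_congr_ae (.of_forall fun x => ?_)
    simp only [Pi.sub_apply, Pi.add_apply]
    ring
  have hu0 := h1Norm_nonneg u
  have hv0 := h1Norm_nonneg v
  have hR : 0 ≤ R := hu0.trans huR
  have huv : h1Norm (u + v) ≤ 2 * R := (h1Norm_add_le hu hv).trans (by linarith)
  have hd := h1Norm_nonneg (u - v)
  have h1 := hT _ _ _ _ (hu.sub hv) (hu.add hv) hu hu
  have h2 := hT _ _ _ _ (hu.sub hv) (hu.add hv) hv hv
  rw [e]
  calc _ ≤ _ := abs_add_le _ _
    _ ≤ C * (h1Norm (u - v) * h1Norm (u + v) * (h1Norm u * h1Norm u)) +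
        C * (h1Norm (u - v) * h1Norm (u + v) * (h1Norm v * h1Norm v)) := add_le_add h1 h2
    _ ≤ C * (h1Norm (u - v) * (2 * R) * (R * R)) + C * (h1Norm (u - v) * (2 * R) * (R * R)) := by
        gcongr
    _ = _ := by ring

theorem normSq_pos (hN : N = 2 ∨ N = 3) {u : Space N → ℝ} (hu : MemH1Radial u) {x : Space N}
    (hx : x ≠ 0) (hux : u x ≠ 0) : 0 < normSq u := by
  obtain ⟨C, hC, h⟩ := exists_sq_le_weight_mul_normSq hN
  have h1 := h u hu x hx
  have h2 : 0 < u x ^ 2 := by positivity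
  have h3 := weight_pos N ‖x‖
  by_contra hcon
  have : normSq u = 0 := le_antisymm (not_lt.1 hcon) (normSq_nonneg u)
  rw [this] at h1
  linarith

theorem eq_zero_of_ae_eq_zero {f : Space N → ℝ} (hf : ContinuousOn f {0}ᶜ)
    (hae : ∀ᵐ x, f x = 0) {x : Space N} (hx : x ≠ 0) : f x = 0 := by
  by_contra hfx
  have h1 : IsOpen ({0}ᶜ ∩ f ⁻¹' {0}ᶜ : Set (Space N)) :=
    hf.isOpen_inter_preimage isOpen_compl_singleton isOpen_compl_singleton
  have h2 : volume ({0}ᶜ ∩ f ⁻¹' {0}ᶜ : Set (Space N)) = 0 :=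
    measure_mono_null (fun z hz => hz.2) hae
  exact (h1.measure_pos volume ⟨x, hx, hfx⟩).ne' h2

theorem integral_pow_four_pos (hN : N = 2 ∨ N = 3) {u : Space N → ℝ} (hu : MemH1Radial u)
    {x : Space N} (hx : x ≠ 0) (hux : u x ≠ 0) : 0 < ∫ x, u x ^ 4 := by
  refine lt_of_le_of_ne (integral_nonneg fun x => by positivity) fun h0 => ?_
  have h1 := (integral_eq_zero_iff_of_nonneg (fun x => by positivity)
    (integrable_pow_four hN hu)).1 h0.symm
  exact hux (eq_zero_of_ae_eq_zero hu.continuousOn (h1.mono fun x hx => by simpa using hx) hx)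

/-- A function on the Nehari manifold has a peak, of a height that does not depend on it. -/
theorem exists_peak (hN : N = 2 ∨ N = 3) :
    ∃ κ : ℝ, 0 < κ ∧ ∀ w : Space N → ℝ, MemH1Radial w → (∃ x, x ≠ 0 ∧ w x ≠ 0) →
      normSq w = ∫ x, w x ^ 4 → ∃ x, x ≠ 0 ∧ κ * weight N ‖x‖ < w x ^ 2 := by
  obtain ⟨C, hC, h⟩ := exists_integral_pow_four_le hN
  refine ⟨1 / (2 * C), by positivity, fun w hw ⟨x, hx, hwx⟩ hne => ?_⟩
  by_contra! hcon
  have h1 := (h w hw (1 / (2 * C)) (by positivity) hcon).2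
  have h2 := normSq_pos hN hw hx hwx
  have h3 : 1 / (2 * C) * C * normSq w = normSq w / 2 := by field_simp
  rw [h3, ← hne] at h1
  linarith

/-- Functions on the Nehari manifold are bounded away from zero. -/
theorem exists_normSq_ge (hN : N = 2 ∨ N = 3) :
    ∃ m : ℝ, 0 < m ∧ ∀ w : Space N → ℝ, MemH1Radial w → (∃ x, x ≠ 0 ∧ w x ≠ 0) →
      normSq w = ∫ x, w x ^ 4 → m ≤ normSq w := by
  obtain ⟨C, hC, h⟩ := exists_sobolev hN
  refine ⟨1 / C, by positivity, fun w hw ⟨x, hx, hwx⟩ hne => ?_⟩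
  have h1 := (h w hw).2
  have h2 := normSq_pos hN hw hx hwx
  rw [← hne] at h1
  rw [div_le_iff₀ hC]
  by_contra hcon
  nlinarith

/-! ### The energy of a nodal tuple -/

theorem IsNodalTuple.mul_eq_zero {w : Fin h → Space N → ℝ} (hw : IsNodalTuple w) {l p : Fin h}
    (hlp : l ≠ p) {x : Space N} (hx : x ≠ 0) : w l x * w p x = 0 := by
  rcases (hw.nonneg l x hx).eq_or_lt with h0 | h0
  · rw [← h0, zero_mul]
  rcases lt_or_gt_of_ne hlp with h1 | h1
  · rw [hw.ordered_gt l p h1 x x hx hx h0 le_rfl, mul_zero]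
  · rw [hw.ordered_lt l p h1 x x hx hx h0 le_rfl, mul_zero]

theorem sum_pow_four_of_mul_eq_zero {ι : Type*} [Fintype ι] {a : ι → ℝ}
    (ha : ∀ i j, i ≠ j → a i * a j = 0) : (∑ i, a i) ^ 4 = ∑ i, a i ^ 4 := by
  by_cases h0 : ∀ i, a i = 0
  · simp [h0]
  push Not at h0
  obtain ⟨i, hi⟩ := h0
  have h1 : ∀ j, j ≠ i → a j = 0 := fun j hj =>
    (mul_eq_zero.1 (ha i j hj.symm)).resolve_left hi
  rw [Finset.sum_eq_single i (fun j _ hj => h1 j hj) (by simp),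
    Finset.sum_eq_single i (fun j _ hj => by simp [h1 j hj]) (by simp)]

theorem ae_ne_zero [NeZero N] : ∀ᵐ x : Space N, x ≠ 0 :=
  Measure.ae_ne (volume : Measure (Space N)) 0

theorem eq_zero_of_eventually_left {f : ℝ → ℝ} {s : ℝ} (hf : ContinuousAt f s)
    (h : ∀ᶠ t in nhdsWithin s (Set.Iio s), f t = 0) : f s = 0 :=
  tendsto_nhds_unique (hf.tendsto.mono_left nhdsWithin_le_nhds)
    (tendsto_const_nhds.congr' (h.mono fun _ ht => ht.symm))

theorem eq_zero_of_eventually_right {f : ℝ → ℝ} {s : ℝ} (hf : ContinuousAt f s)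
    (h : ∀ᶠ t in nhdsWithin s (Set.Ioi s), f t = 0) : f s = 0 :=
  tendsto_nhds_unique (hf.tendsto.mono_left nhdsWithin_le_nhds)
    (tendsto_const_nhds.congr' (h.mono fun _ ht => ht.symm))

theorem IsNodalTuple.exists_pos {w : Fin h → Space N → ℝ} (hw : IsNodalTuple w) (l : Fin h) :
    ∃ x, x ≠ 0 ∧ 0 < w l x := by
  obtain ⟨x, hx, hwx⟩ := hw.nontrivial l
  exact ⟨x, hx, (hw.nonneg l x hx).lt_of_ne' hwx⟩

/-- Two components of a nodal tuple live on the two sides of a sphere. -/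
theorem IsNodalTuple.exists_separating_radius [NeZero N] {w : Fin h → Space N → ℝ}
    (hw : IsNodalTuple w) {l p : Fin h} (hlp : l < p) :
    ∃ s > 0, (∀ x, s ≤ ‖x‖ → w l x = 0) ∧ ∀ x, x ≠ 0 → ‖x‖ ≤ s → w p x = 0 := by
  obtain ⟨x₁, hx₁, hl⟩ := hw.exists_pos l
  obtain ⟨x₂, hx₂, hp⟩ := hw.exists_pos p
  set R : Set ℝ := {r | ∃ x, x ≠ 0 ∧ 0 < w p x ∧ ‖x‖ = r} with hR
  have hne : R.Nonempty := ⟨‖x₂‖, x₂, hx₂, hp, rfl⟩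
  have hlow : ∀ r ∈ R, ‖x₁‖ ≤ r := by
    rintro r ⟨x, hx, hpos, rfl⟩
    by_contra hcon
    exact hpos.ne' (hw.ordered_gt l p hlp x₁ x hx₁ hx hl (not_le.1 hcon).le)
  have hbdd : BddBelow R := ⟨‖x₁‖, hlow⟩
  set s := sInf R with hs
  have hspos : 0 < s := (norm_pos_iff.2 hx₁).trans_le (le_csInf hne hlow)
  have hin : ∀ x, x ≠ 0 → ‖x‖ < s → w p x = 0 := by
    intro x hx hxs
    by_contra hcon
    exact (not_le.2 hxs) (csInf_le hbdd ⟨x, hx, (hw.nonneg p x hx).lt_of_ne' hcon, rfl⟩)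
  have hout : ∀ x, s < ‖x‖ → w l x = 0 := by
    intro x hxs
    have hx : x ≠ 0 := norm_pos_iff.1 (hspos.trans hxs)
    obtain ⟨r, ⟨z, hz, hzp, rfl⟩, hr⟩ := exists_lt_of_csInf_lt hne hxs
    exact hw.ordered_lt p l hlp z x hz hx hzp hr.le
  have hcont : ∀ i, ContinuousAt (profile (w i)) s := fun i =>
    (hw.mem i).continuousOn_profile.continuousAt (Ioi_mem_nhds hspos)
  have hl0 : profile (w l) s = 0 := by
    refine eq_zero_of_eventually_right (hcont l) ?_
    filter_upwards [self_mem_nhdsWithin] with t ht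
    exact hout _ (by rw [norm_smul_unitVec (hspos.trans ht).le]; exact ht)
  have hp0 : profile (w p) s = 0 := by
    refine eq_zero_of_eventually_left (hcont p) ?_
    filter_upwards [self_mem_nhdsWithin, mem_nhdsWithin_of_mem_nhds (Ioi_mem_nhds hspos)]
      with t ht ht0
    have ht0 : 0 < t := ht0
    refine hin _ ?_ (by rw [norm_smul_unitVec ht0.le]; exact ht)
    rw [← norm_pos_iff, norm_smul_unitVec ht0.le]
    exact ht0
  refine ⟨s, hspos, fun x hx => ?_, fun x hx0 hx => ?_⟩
  · rcases hx.eq_or_lt with h1 | h1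
    · rw [(hw.mem l).eq_profile, ← h1, hl0]
    · exact hout x h1
  · rcases hx.eq_or_lt with h1 | h1
    · rw [(hw.mem p).eq_profile, h1, hp0]
    · exact hin x hx0 h1

theorem IsNodalTuple.inner_graphMap_eq_zero [NeZero N] {w : Fin h → Space N → ℝ}
    (hw : IsNodalTuple w) {l p : Fin h} (hlp : l < p) :
    inner ℝ (graphMap N ⟨w l, hw.mem l⟩) (graphMap N ⟨w p, hw.mem p⟩) = 0 := by
  obtain ⟨s, hs, hl, hp⟩ := hw.exists_separating_radius hlp
  have s1 : Splits (Metric.ball 0 s) (w l) :=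
    (hw.mem l).splits_ball hs fun x hx => hl x hx.ge
  have s2 : Splits (Metric.ball 0 s)ᶜ (w p) := by
    refine Splits.compl ((hw.mem p).splits_ball hs fun x hx => hp x ?_ hx.le) (hw.mem p)
    exact norm_pos_iff.1 (hx ▸ hs)
  have e1 : (Metric.ball 0 s).indicator (w l) = w l := by
    rw [Set.indicator_eq_self]
    intro x hx
    by_contra hcon
    exact hx (hl x (by simpa using hcon))
  have e2 : (Metric.ball 0 s)ᶜ.indicator (w p) =ᵐ[volume] w p := by
    filter_upwards [ae_ne_zero] with x hx
    by_cases hxs : x ∈ Metric.ball (0 : Space N) s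
    · have hxs' : ‖x‖ < s := by simpa using hxs
      simp [hp x hx hxs'.le]
    · simp [hxs]
  have g1 := s1.weakGradient_ae
  rw [e1] at g1
  have g2 := (s2.mem.memH1.hasWeakGradient.ae_unique (hw.mem p).memH1.hasWeakGradient e2).symm.trans
    s2.weakGradient_ae
  rw [inner_graphMap]
  have z1 : ∫ x, w l x * w p x = 0 :=
    integral_eq_zero_of_ae (ae_ne_zero.mono fun x hx => hw.mul_eq_zero hlp.ne hx)
  have z2 : ∫ x, inner ℝ (weakGradient (w l) x) (weakGradient (w p) x) = 0 := by
    refine integral_eq_zero_of_ae ?_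
    filter_upwards [g1, g2] with x h1 h2
    rw [h1, h2]
    by_cases hxs : x ∈ Metric.ball (0 : Space N) s <;> simp [hxs]
  rw [z1, z2, add_zero]

theorem IsNodalTuple.normSq_sum [NeZero N] {w : Fin h → Space N → ℝ} (hw : IsNodalTuple w) :
    normSq (fun x => ∑ l, w l x) = ∑ l, normSq (w l) := by
  have e : (fun x => ∑ l, w l x) = (∑ l, (⟨w l, hw.mem l⟩ : radialH1 N) : radialH1 N).1 := by
    ext x
    simp
  have h1 : ∀ l p, l ≠ p →
      inner ℝ (graphMap N ⟨w l, hw.mem l⟩) (graphMap N ⟨w p, hw.mem p⟩) = 0 := by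
    intro l p hlp
    rcases lt_or_gt_of_ne hlp with h2 | h2
    · exact hw.inner_graphMap_eq_zero h2
    · rw [real_inner_comm]
      exact hw.inner_graphMap_eq_zero h2
  rw [e, ← norm_graphMap_sq, map_sum, ← real_inner_self_eq_norm_sq, sum_inner]
  refine Finset.sum_congr rfl fun l _ => ?_
  rw [inner_sum, Finset.sum_eq_single l (fun p _ hp => h1 l p hp.symm) (by simp),
    real_inner_self_eq_norm_sq, norm_graphMap_sq]

/-- On the Nehari set the energy is a quarter of the sum of the squared norms. -/
theorem energy_sum_of_mem_nehariSet (hN : N = 2 ∨ N = 3) {w : Fin h → Space N → ℝ}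
    (hw : w ∈ nehariSet N h) : energy (fun x => ∑ l, w l x) = 1 / 4 * ∑ l, normSq (w l) := by
  have : NeZero N := ⟨by omega⟩
  obtain ⟨hw, hne⟩ := hw
  have h4 : ∫ x, (∑ l, w l x) ^ 4 = ∑ l, normSq (w l) := by
    have e : (fun x => (∑ l, w l x) ^ 4) =ᵐ[volume] fun x => ∑ l, w l x ^ 4 :=
      ae_ne_zero.mono fun x hx => sum_pow_four_of_mul_eq_zero fun i j hij => hw.mul_eq_zero hij hx
    rw [integral_congr_ae e, integral_finsetSum _ fun l _ => integrable_pow_four hN (hw.mem l)]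
    exact Finset.sum_congr rfl fun l _ => (hne l).symm
  rw [energy, hw.normSq_sum, h4]
  ring

theorem normSq_le_of_mem_minimizers (hN : N = 2 ∨ N = 3) {w : Fin h → Space N → ℝ}
    (hw : w ∈ minimizers N h) {c : ℝ} (hc : (c : EReal) = nehariLevel N h) (q : Fin h) :
    normSq (w q) ≤ 4 * c := by
  have h1 := hw.2
  rw [← hc, EReal.coe_eq_coe_iff, energy_sum_of_mem_nehariSet hN hw.1] at h1
  have := Finset.single_le_sum (f := fun l => normSq (w l)) (fun l _ => normSq_nonneg _)
    (Finset.mem_univ q)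
  linarith

/-! ### Minimality -/

/-- A component of an element of the Nehari set may be replaced by any function on the Nehari
manifold that vanishes where the component does. -/
theorem update_mem_nehariSet {w : Fin h → Space N → ℝ}
    (hw : w ∈ nehariSet N h) {q : Fin h} {b : Space N → ℝ} (hb : MemH1Radial b)
    (hb0 : ∀ x, x ≠ 0 → 0 ≤ b x) (hbn : ∃ x, x ≠ 0 ∧ b x ≠ 0)
    (hbw : ∀ x, x ≠ 0 → w q x = 0 → b x = 0) (hne : normSq b = ∫ x, b x ^ 4) :
    Function.update w q b ∈ nehariSet N h := by
  obtain ⟨hw, hwne⟩ := hw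
  have hpos : ∀ l x, x ≠ 0 → 0 < Function.update w q b l x → 0 < w l x := by
    intro l x hx hl
    by_cases hlq : l = q
    · subst hlq
      rw [Function.update_self] at hl
      exact (hw.nonneg l x hx).lt_of_ne' fun h0 => hl.ne' (hbw x hx h0)
    · rwa [Function.update_of_ne hlq] at hl
  have hzero : ∀ l x, x ≠ 0 → w l x = 0 → Function.update w q b l x = 0 := by
    intro l x hx hl
    by_cases hlq : l = q
    · subst hlq
      rw [Function.update_self]
      exact hbw x hx hl
    · rwa [Function.update_of_ne hlq]
  refine ⟨⟨fun l => ?_, fun l => ?_, fun l => ?_, fun l p hpl x₀ x hx₀ hx hl hle => ?_,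
    fun l p hpl x₀ x hx₀ hx hl hle => ?_⟩, fun l => ?_⟩
  · by_cases hlq : l = q
    · subst hlq; simpa using hb
    · simpa [hlq] using hw.mem l
  · by_cases hlq : l = q
    · subst hlq; simpa using hb0
    · simpa [hlq] using hw.nonneg l
  · by_cases hlq : l = q
    · subst hlq; simpa using hbn
    · simpa [hlq] using hw.nontrivial l
  · exact hzero p x hx (hw.ordered_lt l p hpl x₀ x hx₀ hx (hpos l x₀ hx₀ hl) hle)
  · exact hzero p x hx (hw.ordered_gt l p hpl x₀ x hx₀ hx (hpos l x₀ hx₀ hl) hle)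
  · by_cases hlq : l = q
    · subst hlq; simpa using hne
    · simpa [hlq] using hwne l

theorem integral_smul_pow_four (c : ℝ) (u : Space N → ℝ) :
    ∫ x, (c • u) x ^ 4 = c ^ 4 * ∫ x, u x ^ 4 := by
  rw [← integral_const_mul]
  exact integral_congr_ae (.of_forall fun x => by simp [mul_pow])

/-- The least energy property of a component of a minimizer among the functions below it: the
Nehari energy `¼ ‖a‖⁴ / ∫ a⁴` of the ray of `a` is at least `¼ ‖w_q‖²`. -/
theorem normSq_mul_integral_le (hN : N = 2 ∨ N = 3) {w : Fin h → Space N → ℝ}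
    (hw : w ∈ minimizers N h) {q : Fin h} {a : Space N → ℝ} (ha : MemH1Radial a)
    (ha0 : ∀ x, x ≠ 0 → 0 ≤ a x) (haw : ∀ x, x ≠ 0 → a x ≤ w q x) :
    normSq (w q) * ∫ x, a x ^ 4 ≤ normSq a ^ 2 := by
  have : NeZero N := ⟨by omega⟩
  by_cases hex : ∃ x, x ≠ 0 ∧ a x ≠ 0
  swap
  · push Not at hex
    have : ∫ x, a x ^ 4 = 0 :=
      integral_eq_zero_of_ae (ae_ne_zero.mono fun x hx => by simp [hex x hx])
    rw [this, mul_zero]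
    positivity
  obtain ⟨x, hx, hax⟩ := hex
  have hI := integral_pow_four_pos hN ha hx hax
  have hn := normSq_pos hN ha hx hax
  set I := ∫ x, a x ^ 4 with hIdef
  -- `t • a` is the point of the ray of `a` on the Nehari manifold
  set t := √(normSq a / I) with ht
  have ht2 : t ^ 2 = normSq a / I := Real.sq_sqrt (by positivity)
  have htpos : 0 < t := Real.sqrt_pos.2 (by positivity)
  have hmem : Function.update w q (t • a) ∈ nehariSet N h := by
    refine update_mem_nehariSet hw.1 (ha.smul t) (fun z hz => ?_) ⟨x, hx, ?_⟩ (fun z hz h0 => ?_) ?_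
    · exact mul_nonneg htpos.le (ha0 z hz)
    · exact mul_ne_zero htpos.ne' hax
    · have : a z = 0 := le_antisymm (h0 ▸ haw z hz) (ha0 z hz)
      simp [this]
    · rw [normSq_smul ha, integral_smul_pow_four, ← hIdef, show t ^ 4 = t ^ 2 * t ^ 2 by ring, ht2]
      field_simp
  have hle : nehariLevel N h ≤
      ((energy (fun x => ∑ l, Function.update w q (t • a) l x) : ℝ) : EReal) := iInf₂_le _ hmem
  rw [← hw.2, EReal.coe_le_coe_iff, energy_sum_of_mem_nehariSet hN hw.1,
    energy_sum_of_mem_nehariSet hN hmem] at hle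
  have e1 := Finset.add_sum_erase Finset.univ (fun l => normSq (w l)) (Finset.mem_univ q)
  have e2 := Finset.add_sum_erase Finset.univ (fun l => normSq (Function.update w q (t • a) l))
    (Finset.mem_univ q)
  have e3 : ∑ l ∈ Finset.univ.erase q, normSq (Function.update w q (t • a) l) =
      ∑ l ∈ Finset.univ.erase q, normSq (w l) :=
    Finset.sum_congr rfl fun l hl => by rw [Function.update_of_ne (Finset.ne_of_mem_erase hl)]
  simp only [Function.update_self] at e2
  rw [normSq_smul ha, ht2] at e2
  have h5 : normSq (w q) ≤ normSq a / I * normSq a := by linarith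
  calc normSq (w q) * I ≤ normSq a / I * normSq a * I := by gcongr
    _ = _ := by field_simp

/-! ### Splitting a function near a minimizer along a sphere -/

theorem exists_first_zero {f : ℝ → ℝ} {a b : ℝ} (hab : a ≤ b) (hf : ContinuousOn f (Set.Icc a b))
    (ha : 0 < f a) (hb : f b ≤ 0) :
    ∃ s, a < s ∧ s ≤ b ∧ f s = 0 ∧ ∀ t, a ≤ t → t < s → 0 < f t := by
  set K : Set ℝ := Set.Icc a b ∩ f ⁻¹' Set.Iic 0 with hK
  have hKc : IsCompact K :=
    isCompact_Icc.of_isClosed_subset (hf.preimage_isClosed_of_isClosed isClosed_Icc isClosed_Iic)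
      Set.inter_subset_left
  obtain ⟨s, hs⟩ := hKc.exists_isLeast ⟨b, ⟨hab, le_rfl⟩, hb⟩
  have hlt : ∀ t, a ≤ t → t < s → 0 < f t := by
    intro t hat hts
    by_contra hcon
    exact (not_le.2 hts) (hs.2 ⟨⟨hat, hts.le.trans hs.1.1.2⟩, not_lt.1 hcon⟩)
  have has : a < s := by
    refine lt_of_le_of_ne hs.1.1.1 fun h => ?_
    have := hs.1.2
    rw [← h] at this
    exact (not_le.2 ha) this
  refine ⟨s, has, hs.1.1.2, le_antisymm hs.1.2 ?_, hlt⟩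
  by_contra hcon
  push Not at hcon
  obtain ⟨t, ht, ht0⟩ := intermediate_value_Icc' has.le
    (hf.mono (Set.Icc_subset_Icc_right hs.1.1.2)) ⟨hcon.le, ha.le⟩
  have hts : t < s := lt_of_le_of_ne ht.2 fun h => by rw [h] at ht0; exact hcon.ne ht0
  exact (hlt t ht.1 hts).ne' ht0

theorem exists_last_zero {f : ℝ → ℝ} {a b : ℝ} (hab : a ≤ b) (hf : ContinuousOn f (Set.Icc a b))
    (ha : f a ≤ 0) (hb : 0 < f b) :
    ∃ s, a ≤ s ∧ s < b ∧ f s = 0 ∧ ∀ t, s < t → t ≤ b → 0 < f t := by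
  obtain ⟨s, h1, h2, h3, h4⟩ := exists_first_zero (f := fun t => f (-t)) (a := -b) (b := -a)
    (by linarith) (hf.comp (by fun_prop) fun t ht => ⟨by linarith [ht.2], by linarith [ht.1]⟩)
    (by simpa using hb) (by simpa using ha)
  exact ⟨-s, by linarith, by linarith, h3, fun t ht1 ht2 => by
    simpa using h4 (-t) (by linarith) (by linarith)⟩

theorem h1Norm_zero : h1Norm (0 : Space N → ℝ) = 0 := by
  have h0 : MemH1Radial (0 : Space N → ℝ) := (radialH1 N).zero_mem
  have := normSq_smul h0 0
  rw [zero_smul, zero_pow two_ne_zero, zero_mul] at this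
  rw [h1Norm, this, Real.sqrt_zero]

theorem Splits.h1Norm_indicator_le {B : Set (Space N)} {u : Space N → ℝ} (hB : Splits B u)
    (hu : MemH1Radial u) : h1Norm (B.indicator u) ≤ h1Norm u :=
  h1Norm_le_of_normSq_le (hB.normSq_indicator_le hu)

/-- If `v` vanishes on a sphere, then `w` can be lowered to a function that vanishes there as well,
at the cost of at most the distance of `v` and `w`: it is replaced by `v` on the component of
`{v < w}` that contains the sphere. -/
theorem exists_truncation [NeZero N] {w v : Space N → ℝ} (hw : MemH1Radial w)
    (hv : MemH1Radial v) (hw0 : ∀ x, x ≠ 0 → 0 ≤ w x) (hv0 : ∀ x, x ≠ 0 → 0 ≤ v x) {s : ℝ}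
    (hs : 0 < s) (hvs : ∀ x, ‖x‖ = s → v x = 0) :
    ∃ y, MemH1Radial y ∧ (∀ x, x ≠ 0 → 0 ≤ y x) ∧ (∀ x, x ≠ 0 → y x ≤ w x) ∧
      (∀ x, ‖x‖ = s → y x = 0) ∧ h1Norm (y - w) ≤ h1Norm (w - v) := by
  have hu := hw.sub hv
  set u := w - v with hudef
  have hne : ∀ x : Space N, ‖x‖ = s → x ≠ 0 := fun x hx => norm_pos_iff.1 (hx ▸ hs)
  have hcont := hu.continuousOn_profile
  by_cases hfs : profile u s ≤ 0
  · refine ⟨w, hw, hw0, fun x _ => le_rfl, fun x hx => ?_, ?_⟩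
    · have h1 : u x ≤ 0 := by rw [hu.eq_profile, hx]; exact hfs
      have h2 : u x = w x - v x := rfl
      have := hw0 x (hne x hx)
      rw [hvs x hx] at h2
      linarith
    · rw [sub_self, h1Norm_zero]
      exact h1Norm_nonneg _
  push Not at hfs
  -- the inner boundary of the component of `{v < w}`, if it does not reach the origin
  have inner : ∃ B : Set (Space N), Splits B u ∧ (∀ x, ‖x‖ = s → x ∉ B) ∧
      ∀ x, x ≠ 0 → x ∉ B → ‖x‖ ≤ s → 0 ≤ u x := by
    by_cases hex : ∃ t, 0 < t ∧ t < s ∧ profile u t ≤ 0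
    · obtain ⟨t, ht0, hts, hft⟩ := hex
      obtain ⟨α, h1, h2, h3, h4⟩ := exists_last_zero hts.le
        (hcont.mono fun r hr => ht0.trans_le hr.1) hft hfs
      have hα : 0 < α := ht0.trans_le h1
      refine ⟨Metric.ball 0 α, hu.splits_ball hα fun x hx => ?_, fun x hx => ?_,
        fun x hx hxB hxs => ?_⟩
      · rw [hu.eq_profile, hx, h3]
      · simp [hx, h2.le]
      · have hxα : α ≤ ‖x‖ := by simpa using hxB
        rw [hu.eq_profile]
        rcases hxα.eq_or_lt with h5 | h5
        · rw [← h5, h3]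
        · exact (h4 _ h5 hxs).le
    · push Not at hex
      refine ⟨∅, hu.splits_empty, fun x hx => by simp, fun x hx _ hxs => ?_⟩
      rw [hu.eq_profile]
      rcases hxs.eq_or_lt with h5 | h5
      · rw [h5]; exact hfs.le
      · exact (hex _ (norm_pos_iff.2 hx) h5).le
  obtain ⟨B, hB, hBs, hBu⟩ := inner
  -- the outer boundary of the component, if it does not reach infinity
  have outer : ∃ B' : Set (Space N), Splits B' (Bᶜ.indicator u) ∧ (∀ x, ‖x‖ = s → x ∈ B') ∧
      ∀ x, x ∈ B' → s ≤ ‖x‖ → 0 ≤ u x := by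
    by_cases hex : ∃ t, s < t ∧ profile u t ≤ 0
    · obtain ⟨t, hts, hft⟩ := hex
      obtain ⟨β, h1, h2, h3, h4⟩ := exists_first_zero hts.le
        (hcont.mono fun r hr => hs.trans_le hr.1) hfs hft
      refine ⟨Metric.ball 0 β, (hB.compl hu).mem.splits_ball (hs.trans h1) fun x hx => ?_,
        fun x hx => by simpa [hx] using h1, fun x hx hsx => ?_⟩
      · have : u x = 0 := by rw [hu.eq_profile, hx, h3]
        simp [this]
      · rw [hu.eq_profile]
        exact (h4 _ hsx (by simpa using hx)).le
    · push Not at hex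
      refine ⟨Set.univ, (hB.compl hu).mem.splits_univ, fun x _ => trivial, fun x _ hxs => ?_⟩
      rw [hu.eq_profile]
      rcases hxs.eq_or_lt with h5 | h5
      · rw [← h5]; exact hfs.le
      · exact (hex _ h5).le
  obtain ⟨B', hB', hBs', hBu'⟩ := outer
  set D := B' ∩ Bᶜ with hD
  have hDs : Splits D u := (hB.compl hu).inter hB'
  have hDu : ∀ x, x ≠ 0 → x ∈ D → 0 ≤ u x := by
    intro x hx hxD
    rcases le_total ‖x‖ s with h5 | h5
    · exact hBu x hx hxD.2 h5
    · exact hBu' x hxD.1 h5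
  classical
  have hval : ∀ x, (w - D.indicator u) x = if x ∈ D then v x else w x := by
    intro x
    by_cases hx : x ∈ D <;> simp [hx, hudef]
  refine ⟨w - D.indicator u, hw.sub hDs.mem, fun x hx => ?_, fun x hx => ?_, fun x hx => ?_, ?_⟩
  · rw [hval]
    split_ifs
    exacts [hv0 x hx, hw0 x hx]
  · rw [hval]
    split_ifs with hxD
    · have h1 := hDu x hx hxD
      have h2 : u x = w x - v x := rfl
      linarith
    · exact le_rfl
  · rw [hval, if_pos ⟨hBs' x hx, hBs x hx⟩, hvs x hx]
  · rw [sub_sub_cancel_left, h1Norm_neg hDs.mem]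
    exact hDs.h1Norm_indicator_le hu

theorem integral_indicator_pow_four_add (hN : N = 2 ∨ N = 3) {u : Space N → ℝ}
    (hu : MemH1Radial u) {B : Set (Space N)} (hB : MeasurableSet B) :
    (∫ x, B.indicator u x ^ 4) + ∫ x, Bᶜ.indicator u x ^ 4 = ∫ x, u x ^ 4 := by
  have e : ∀ B : Set (Space N), MeasurableSet B →
      ∫ x, B.indicator u x ^ 4 = ∫ x in B, u x ^ 4 := by
    intro B hB
    rw [← integral_indicator hB]
    exact integral_congr_ae (.of_forall fun x => by by_cases hx : x ∈ B <;> simp [hx])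
  rw [e B hB, e _ hB.compl, integral_add_compl hB (integrable_pow_four hN hu)]

theorem indicator_sub_fun (B : Set (Space N)) (u v : Space N → ℝ) :
    B.indicator (u - v) = B.indicator u - B.indicator v := Set.indicator_sub B u v

/-- A function close to a component of a minimizer cannot have mass on both sides of a sphere on
which it vanishes: otherwise one of the two pieces would have less energy than the component. -/
theorem exists_split_bound (hN : N = 2 ∨ N = 3) (R : ℝ) (hR : 0 < R) :
    ∃ K : ℝ, 0 < K ∧ ∀ w ∈ minimizers N h, ∀ q, h1Norm (w q) ≤ R → ∀ v : Space N → ℝ,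
      MemH1Radial v → (∀ x, x ≠ 0 → 0 ≤ v x) → ∀ ε ≤ R, h1Norm (v - w q) ≤ ε → ∀ s > 0,
      (∀ x, ‖x‖ = s → v x = 0) → ∃ A B : ℝ, 0 ≤ A ∧ 0 ≤ B ∧ A ^ 2 * B ^ 2 ≤ K * ε ∧
        h1Norm ((Metric.ball 0 s).indicator v) ≤ A + 2 * ε ∧
        h1Norm ((Metric.ball 0 s)ᶜ.indicator v) ≤ B + 2 * ε := by
  have : NeZero N := ⟨by omega⟩
  obtain ⟨C, hC, hI⟩ := exists_abs_integral_pow_four_sub_le hN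
  refine ⟨15 * R ^ 3 + 8 * C * R ^ 5, by positivity, ?_⟩
  intro w hw q hwR v hv hv0 ε hεR hvw s hs hvs
  have hwq : MemH1Radial (w q) := hw.1.1.mem q
  have hε0 : 0 ≤ ε := (h1Norm_nonneg _).trans hvw
  obtain ⟨y, hy, hy0, hyw, hys, hyd⟩ :=
    exists_truncation hwq hv (hw.1.1.nonneg q) hv0 hs hvs
  have hyε : h1Norm (y - w q) ≤ ε := hyd.trans (by rwa [h1Norm_sub_comm hwq hv])
  have sy : Splits (Metric.ball 0 s) y := hy.splits_ball hs hys
  have hvy : MemH1Radial (v - y) := hv.sub hy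
  have svy : Splits (Metric.ball 0 s) (v - y) :=
    hvy.splits_ball hs fun x hx => by simp [hvs x hx, hys x hx]
  have hvyn : h1Norm (v - y) ≤ 2 * ε := by
    have h1 := h1Norm_add_le (hv.sub hwq) (hwq.sub hy)
    rw [sub_add_sub_cancel, h1Norm_sub_comm hwq hy] at h1
    linarith
  have hpiece : ∀ B : Set (Space N), Splits B y → Splits B (v - y) →
      h1Norm (B.indicator v) ≤ h1Norm (B.indicator y) + 2 * ε := by
    intro B h1 h2
    have h3 := h1Norm_add_le h1.mem h2.mem
    rw [indicator_sub_fun, add_sub_cancel, ← indicator_sub_fun] at h3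
    have h4 := h2.h1Norm_indicator_le hvy
    linarith
  have hmin : ∀ B : Set (Space N), Splits B y →
      normSq (w q) * ∫ x, B.indicator y x ^ 4 ≤ normSq (B.indicator y) ^ 2 := by
    intro B hB
    refine normSq_mul_integral_le hN hw hB.mem (fun x hx => ?_) fun x hx => ?_
    · exact Set.indicator_apply_nonneg fun _ => hy0 x hx
    · by_cases hxB : x ∈ B
      · simpa [hxB] using hyw x hx
      · simpa [hxB] using hw.1.1.nonneg q x hx
  refine ⟨h1Norm ((Metric.ball 0 s).indicator y), h1Norm ((Metric.ball 0 s)ᶜ.indicator y),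
    h1Norm_nonneg _, h1Norm_nonneg _, ?_, hpiece _ sy svy,
    hpiece _ (sy.compl hy) (svy.compl hvy)⟩
  have m1 := hmin _ sy
  have m2 := hmin _ (sy.compl hy)
  have i1 := integral_indicator_pow_four_add hN hy sy.measurableSet
  have n1 := sy.normSq_add_compl hy
  have hyR : h1Norm y ≤ h1Norm (w q) + ε := (h1Norm_le_add hy hwq).trans (by linarith)
  have i2 := hI (2 * R) y (w q) hy hwq (by linarith) (by linarith)
  rw [← hw.1.2 q] at i2
  have i3 := (abs_le.1 i2).1
  rw [h1Norm_sq, h1Norm_sq]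
  have hY := h1Norm_sq y
  have hW := h1Norm_sq (w q)
  have hy' := h1Norm_nonneg y
  have hw' := h1Norm_nonneg (w q)
  have hd' := h1Norm_nonneg (y - w q)
  generalize normSq ((Metric.ball 0 s).indicator y) = a at *
  generalize normSq ((Metric.ball 0 s)ᶜ.indicator y) = b at *
  generalize (∫ x, (Metric.ball 0 s).indicator y x ^ 4) = ia at *
  generalize (∫ x, (Metric.ball 0 s)ᶜ.indicator y x ^ 4) = ib at *
  generalize (∫ x, y x ^ 4) = iy at *
  generalize normSq y = ny at *
  generalize normSq (w q) = nw at *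
  generalize h1Norm y = Y at *
  generalize h1Norm (w q) = W at *
  generalize h1Norm (y - w q) = d at *
  have hnwR : nw ≤ R ^ 2 := by rw [← hW]; gcongr
  have hnw0 : 0 ≤ nw := by rw [← hW]; positivity
  have hny0 : 0 ≤ ny := by rw [← hY]; positivity
  have hd1 : ny - nw ≤ 3 * R * ε := by
    rw [← hW, ← hY]
    nlinarith
  have hsum : ny + nw ≤ 5 * R ^ 2 := by
    rw [← hY]
    nlinarith
  have h1 : ny ^ 2 - nw ^ 2 ≤ 15 * R ^ 3 * ε := by
    have : (ny - nw) * (ny + nw) ≤ 3 * R * ε * (5 * R ^ 2) :=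
      mul_le_mul hd1 hsum (by positivity) (by positivity)
    linarith
  have h2 : nw - iy ≤ C * (2 * R) ^ 3 * ε := by
    have : C * (2 * R) ^ 3 * d ≤ C * (2 * R) ^ 3 * ε := by gcongr
    linarith
  have h3 : nw * (nw - iy) ≤ R ^ 2 * (C * (2 * R) ^ 3 * ε) :=
    (mul_le_mul_of_nonneg_left h2 hnw0).trans (by gcongr)
  have h4 : 2 * (a * b) ≤ ny ^ 2 - nw * iy := by
    rw [← n1, ← i1]
    linarith
  have h5 : ny ^ 2 - nw * iy = (ny ^ 2 - nw ^ 2) + nw * (nw - iy) := by ring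
  have h6 : 0 ≤ (15 * R ^ 3 + 8 * C * R ^ 5) * ε := by positivity
  have h7 : R ^ 2 * (C * (2 * R) ^ 3 * ε) = 8 * C * R ^ 5 * ε := by ring
  linarith

/-- The peaks of a minimizer determine on which side of a sphere the mass of a nearby function
lies. -/
theorem exists_peaks (hN : N = 2 ∨ N = 3) (R : ℝ) (hR : 1 ≤ R) (δ : ℝ) (hδ : 0 < δ) :
    ∃ ε : ℝ, 0 < ε ∧ ε ≤ 1 ∧ ∀ w ∈ minimizers N h, (∀ q, h1Norm (w q) ≤ R) →
      ∀ v : Fin h → Space N → ℝ, (∀ q, MemH1Radial (v q)) → (∀ q x, x ≠ 0 → 0 ≤ v q x) →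
      (∀ q, h1Norm (v q - w q) ≤ ε) → ∃ z : Fin h → Space N,
        (∀ q, z q ≠ 0 ∧ 0 < w q (z q) ∧ 0 < v q (z q)) ∧
        ∀ q s, 0 < s → (∀ x, ‖x‖ = s → v q x = 0) →
          (‖z q‖ < s → h1Norm ((Metric.ball 0 s)ᶜ.indicator (v q)) ≤ δ) ∧
          (s < ‖z q‖ → h1Norm ((Metric.ball 0 s).indicator (v q)) ≤ δ) := by
  have : NeZero N := ⟨by omega⟩
  obtain ⟨K, hK, hsplit⟩ := exists_split_bound (h := h) hN R (by linarith)
  obtain ⟨κ, hκ, hpeak⟩ := exists_peak hN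
  obtain ⟨C, hC, hpt⟩ := exists_sq_le_weight_mul_normSq hN
  -- `ρ` bounds from below the norm of a function that has a peak of half the standard height
  set ρ := √(κ / (4 * C)) with hρ
  have hρ2 : ρ ^ 2 = κ / (4 * C) := Real.sq_sqrt (by positivity)
  have hρ0 : 0 < ρ := Real.sqrt_pos.2 (by positivity)
  set ε := min 1 (min ρ (min (ρ / 4) (min (δ / 4) (ρ ^ 2 * δ ^ 2 / (16 * K))))) with hε
  have hε0 : 0 < ε := by positivity
  have e1 : ε ≤ 1 := min_le_left _ _
  have e2 : ε ≤ ρ := (min_le_right _ _).trans (min_le_left _ _)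
  have e3 : ε ≤ ρ / 4 :=
    (min_le_right _ _).trans ((min_le_right _ _).trans (min_le_left _ _))
  have e4 : ε ≤ δ / 4 := (min_le_right _ _).trans ((min_le_right _ _).trans
    ((min_le_right _ _).trans (min_le_left _ _)))
  have e5 : ε ≤ ρ ^ 2 * δ ^ 2 / (16 * K) := (min_le_right _ _).trans ((min_le_right _ _).trans
    ((min_le_right _ _).trans (min_le_right _ _)))
  clear_value ε
  refine ⟨ε, hε0, e1, fun w hw hwR v hv hv0 hvw => ?_⟩
  have hex : ∀ q, ∃ x, x ≠ 0 ∧ κ * weight N ‖x‖ < w q x ^ 2 := fun q =>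
    hpeak (w q) (hw.1.1.mem q) (hw.1.1.nontrivial q) (hw.1.2 q)
  choose z hz0 hz using hex
  have hwpos : ∀ q, 0 < w q (z q) := by
    intro q
    have h1 := hw.1.1.nonneg q (z q) (hz0 q)
    refine lt_of_le_of_ne h1 fun h0 => ?_
    have h2 := hz q
    have h3 := weight_pos N ‖z q‖
    rw [← h0] at h2
    have : 0 < κ * weight N ‖z q‖ := by positivity
    norm_num at h2
    linarith
  have hvz : ∀ q, w q (z q) / 2 ≤ v q (z q) := by
    intro q
    have h1 := hpt _ ((hv q).sub (hw.1.1.mem q)) (z q) (hz0 q)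
    have h2 : normSq (v q - w q) ≤ ρ ^ 2 := by
      rw [← h1Norm_sq]
      have := h1Norm_nonneg (v q - w q)
      gcongr
      exact (hvw q).trans e2
    have h3 := weight_pos N ‖z q‖
    have h4 : (v q (z q) - w q (z q)) ^ 2 ≤ (w q (z q) / 2) ^ 2 := by
      calc (v q (z q) - w q (z q)) ^ 2 ≤ C * weight N ‖z q‖ * normSq (v q - w q) := h1
        _ ≤ C * weight N ‖z q‖ * ρ ^ 2 := by gcongr
        _ = κ * weight N ‖z q‖ / 4 := by rw [hρ2]; field_simp
        _ ≤ _ := by linarith [hz q]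
    have h5 := abs_le_of_sq_le_sq' h4 (by linarith [hwpos q])
    linarith [h5.1]
  have hvpos : ∀ q, 0 < v q (z q) := fun q => (half_pos (hwpos q)).trans_le (hvz q)
  have hbig : ∀ q (B : Set (Space N)), Splits B (v q) → z q ∈ B →
      ρ ≤ h1Norm (B.indicator (v q)) := by
    intro q B hB hzB
    have h1 := hpt _ hB.mem (z q) (hz0 q)
    rw [Set.indicator_of_mem hzB] at h1
    have h3 := weight_pos N ‖z q‖
    have h4 : κ * weight N ‖z q‖ / 4 ≤ v q (z q) ^ 2 := by
      have : (w q (z q) / 2) ^ 2 ≤ v q (z q) ^ 2 := by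
        have := hwpos q
        have := hvz q
        gcongr
      linarith [hz q]
    refine Real.le_sqrt_of_sq_le ?_
    rw [hρ2, div_le_iff₀ (by positivity)]
    have h5 : weight N ‖z q‖ * κ ≤ weight N ‖z q‖ * (normSq (B.indicator (v q)) * (4 * C)) := by
      linarith
    exact le_of_mul_le_mul_left h5 h3
  have harith : ∀ A B : ℝ, 0 ≤ A → 0 ≤ B → A ^ 2 * B ^ 2 ≤ K * ε → ρ ≤ A + 2 * ε →
      B + 2 * ε ≤ δ := by
    intro A B hA hB hAB hρA
    have h1 : ρ / 2 ≤ A := by linarith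
    have h2 : (ρ / 2) ^ 2 * B ^ 2 ≤ (ρ / 2) ^ 2 * (δ / 2) ^ 2 := by
      calc (ρ / 2) ^ 2 * B ^ 2 ≤ A ^ 2 * B ^ 2 := by gcongr
        _ ≤ K * ε := hAB
        _ ≤ K * (ρ ^ 2 * δ ^ 2 / (16 * K)) := by gcongr
        _ = _ := by field_simp; ring
    have h3 := le_of_mul_le_mul_left h2 (by positivity)
    have h4 : B ≤ δ / 2 := (sq_le_sq₀ hB (by positivity)).1 h3
    linarith
  refine ⟨z, fun q => ⟨hz0 q, hwpos q, hvpos q⟩, fun q s hs hvs => ?_⟩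
  obtain ⟨A, B, hA, hB, hAB, h1, h2⟩ := hsplit w hw q (hwR q) (v q) (hv q) (hv0 q) ε
    (by linarith) (hvw q) s hs hvs
  have sv := (hv q).splits_ball hs hvs
  constructor
  · intro hzs
    have h3 := hbig q _ sv (by simpa using hzs)
    exact h2.trans (harith A B hA hB hAB (h3.trans h1))
  · intro hzs
    have h3 := hbig q _ (sv.compl (hv q)) (by simpa using hzs.le)
    exact h1.trans (harith B A hB hA (by linarith) (h3.trans h2))

/-! ### The separating spheres -/

/-- Between two peaks of different components there is a sphere on which all components vanish: the
first zero of the component of the first peak. -/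
theorem exists_common_zero [NeZero N] {k : ℕ} {σ : Fin h → Fin k} {v : Fin h → Space N → ℝ}
    (hv : ∀ q, MemH1Radial (v q)) (hv0 : ∀ q x, x ≠ 0 → 0 ≤ v q x)
    (hdisj : ∀ q p, σ q ≠ σ p → ∀ x, x ≠ 0 → v q x * v p x = 0) {l p : Fin h} (hlp : σ l ≠ σ p)
    {a b : Space N} (ha : a ≠ 0) (hab : ‖a‖ < ‖b‖) (hla : 0 < v l a) (hpb : 0 < v p b) :
    ∃ s, ‖a‖ < s ∧ s < ‖b‖ ∧ ∀ q x, ‖x‖ = s → v q x = 0 := by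
  have ha0 : 0 < ‖a‖ := norm_pos_iff.2 ha
  have hb : b ≠ 0 := norm_pos_iff.1 (ha0.trans hab)
  set f : ℝ → ℝ := fun t => ∑ q with σ q = σ l, profile (v q) t with hf
  have hval : ∀ q (x : Space N), profile (v q) ‖x‖ = v q x := fun q x => ((hv q).eq_profile x).symm
  have hray : ∀ t : ℝ, 0 < t → t • unitVec N ≠ 0 := fun t ht => by
    rw [← norm_pos_iff, norm_smul_unitVec ht.le]
    exact ht
  have hprof0 : ∀ q t, 0 < t → 0 ≤ profile (v q) t := fun q t ht => hv0 q _ (hray t ht)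
  have hfc : ContinuousOn f (Set.Ioi 0) :=
    continuousOn_finsetSum _ fun q _ => (hv q).continuousOn_profile
  have hfa : 0 < f ‖a‖ := by
    refine Finset.sum_pos' (fun q _ => hprof0 q _ ha0) ⟨l, by simp, ?_⟩
    rw [hval]
    exact hla
  have hfb : f ‖b‖ ≤ 0 := by
    refine (Finset.sum_eq_zero fun q hq => ?_).le
    have hq : σ q = σ l := by simpa using hq
    rw [hval]
    exact (mul_eq_zero.1 (hdisj q p (hq ▸ hlp) b hb)).resolve_right hpb.ne'
  obtain ⟨s, h1, h2, h3, h4⟩ := exists_first_zero hab.le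
    (hfc.mono fun r hr => ha0.trans_le hr.1) hfa hfb
  have hs : 0 < s := ha0.trans h1
  have hzero : ∀ q, profile (v q) s = 0 := by
    intro q
    by_cases hq : σ q = σ l
    · exact (Finset.sum_eq_zero_iff_of_nonneg fun i _ => hprof0 i s hs).1 h3 q (by simpa using hq)
    · refine eq_zero_of_eventually_left
        ((hv q).continuousOn_profile.continuousAt (Ioi_mem_nhds hs)) ?_
      filter_upwards [self_mem_nhdsWithin, mem_nhdsWithin_of_mem_nhds (Ioi_mem_nhds h1)]
        with t ht hta
      have ht0 : 0 < t := ha0.trans hta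
      have hft := h4 t (le_of_lt hta) ht
      obtain ⟨i, hi, hipos⟩ := Finset.exists_lt_of_sum_lt (f := fun _ => (0 : ℝ))
        (by simpa using hft)
      have hi : σ i = σ l := by simpa using hi
      exact (mul_eq_zero.1 (hdisj q i (fun h => hq (h.trans hi)) _ (hray t ht0))).resolve_right
        hipos.ne'
  have hall : ∀ q x, ‖x‖ = s → v q x = 0 := fun q x hx => by rw [← hval, hx, hzero]
  refine ⟨s, h1, lt_of_le_of_ne h2 fun h => hpb.ne' (hall p b h.symm), hall⟩

/-- Nested balls, centred at the origin, that separate consecutive pulses. -/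
theorem exists_levels [NeZero N] (hh : 0 < h) {k : ℕ} {σ : Fin h → Fin k}
    (hσ : ∀ l p : Fin h, (p : ℕ) = l + 1 → σ p ≠ σ l) {v : Fin h → Space N → ℝ}
    (hv : ∀ q, MemH1Radial (v q)) (hv0 : ∀ q x, x ≠ 0 → 0 ≤ v q x)
    (hdisj : ∀ q p, σ q ≠ σ p → ∀ x, x ≠ 0 → v q x * v p x = 0) {z : Fin h → Space N}
    (hz : ∀ q, z q ≠ 0 ∧ 0 < v q (z q)) (hmono : ∀ l p, l < p → ‖z l‖ < ‖z p‖) {δ : ℝ}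
    (hδ : 0 ≤ δ)
    (hside : ∀ q s, 0 < s → (∀ x, ‖x‖ = s → v q x = 0) →
      (‖z q‖ < s → h1Norm ((Metric.ball 0 s)ᶜ.indicator (v q)) ≤ δ) ∧
      (s < ‖z q‖ → h1Norm ((Metric.ball 0 s).indicator (v q)) ≤ δ)) :
    ∃ L : ℕ → Set (Space N), L 0 = ∅ ∧ L h = Set.univ ∧ Monotone L ∧
      (∀ n x y, ‖y‖ ≤ ‖x‖ → x ∈ L n → y ∈ L n) ∧
      (∀ u, MemH1Radial u → (∀ x, (∀ q, v q x = 0) → u x = 0) → ∀ n, Splits (L n) u) ∧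
      (∀ (q : Fin h) n, (q : ℕ) < n → z q ∈ L n ∧ h1Norm ((L n)ᶜ.indicator (v q)) ≤ δ) ∧
      ∀ (q : Fin h) n, n ≤ (q : ℕ) → z q ∉ L n ∧ h1Norm ((L n).indicator (v q)) ≤ δ := by
  have hex : ∀ n : ℕ, ∃ s : ℝ, 0 < n → n < h → 0 < s ∧ (∀ q x, ‖x‖ = s → v q x = 0) ∧
      (∀ q : Fin h, (q : ℕ) < n → ‖z q‖ < s) ∧ ∀ q : Fin h, n ≤ (q : ℕ) → s < ‖z q‖ := by
    intro n
    by_cases hn : 0 < n ∧ n < h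
    swap
    · exact ⟨0, fun h1 h2 => absurd ⟨h1, h2⟩ hn⟩
    obtain ⟨hn0, hnh⟩ := hn
    set l : Fin h := ⟨n - 1, by omega⟩ with hl
    set p : Fin h := ⟨n, hnh⟩ with hp
    have hlp : l < p := by simp [hl, hp, Fin.lt_def]; omega
    obtain ⟨s, h1, h2, h3⟩ := exists_common_zero hv hv0 hdisj
      (hσ l p (by simp [hl, hp]; omega)).symm (hz l).1 (hmono l p hlp) (hz l).2 (hz p).2
    have hle : ∀ i j : Fin h, i ≤ j → ‖z i‖ ≤ ‖z j‖ := fun i j hij =>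
      hij.eq_or_lt.elim (fun h => by rw [h]) fun h => (hmono i j h).le
    refine ⟨s, fun _ _ => ⟨(norm_nonneg _).trans_lt h1, h3, fun q hq => ?_, fun q hq => ?_⟩⟩
    · refine (hle q l ?_).trans_lt h1
      simp only [hl, Fin.le_def]
      omega
    · refine h2.trans_le (hle p q ?_)
      simpa [hp, Fin.le_def] using hq
  choose s hs using hex
  set L : ℕ → Set (Space N) := fun n =>
    if n = 0 then ∅ else if n < h then Metric.ball 0 (s n) else Set.univ with hL
  have L0 : L 0 = ∅ := by simp [hL]
  have Lb : ∀ n, 0 < n → n < h → L n = Metric.ball 0 (s n) := fun n h1 h2 => by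
    simp [hL, h1.ne', h2]
  have Lu : ∀ n, h ≤ n → L n = Set.univ := fun n h1 => by
    have h2 : n ≠ 0 := by omega
    simp [hL, h2, not_lt.2 h1]
  have cases_n : ∀ n, n = 0 ∨ (0 < n ∧ n < h) ∨ h ≤ n := fun n => by omega
  refine ⟨L, L0, Lu h le_rfl, monotone_nat_of_le_succ fun n => ?_, fun n x y hyx hx => ?_,
    fun u hu hu0 n => ?_, fun q n hqn => ?_, fun q n hnq => ?_⟩
  · rcases cases_n n with rfl | ⟨h1, h2⟩ | h1
    · rw [L0]
      exact Set.empty_subset _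
    · rcases lt_or_ge (n + 1) h with h3 | h3
      · rw [Lb n h1 h2, Lb (n + 1) (by omega) h3]
        refine Metric.ball_subset_ball ?_
        have := (hs n h1 h2).2.2.2 ⟨n, h2⟩ le_rfl
        have := (hs (n + 1) (by omega) h3).2.2.1 ⟨n, h2⟩ (Nat.lt_succ_self n)
        linarith
      · rw [Lu _ h3]
        exact Set.subset_univ _
    · rw [Lu (n + 1) (by omega)]
      exact Set.subset_univ _
  · rcases cases_n n with rfl | ⟨h1, h2⟩ | h1
    · rw [L0] at hx
      exact hx.elim
    · rw [Lb n h1 h2] at hx ⊢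
      have : ‖x‖ < s n := by simpa using hx
      simpa using hyx.trans_lt this
    · rw [Lu n h1]
      trivial
  · rcases cases_n n with rfl | ⟨h1, h2⟩ | h1
    · rw [L0]
      exact hu.splits_empty
    · rw [Lb n h1 h2]
      obtain ⟨h3, h4, -⟩ := hs n h1 h2
      exact hu.splits_ball h3 fun x hx => hu0 x fun q => h4 q x hx
    · rw [Lu n h1]
      exact hu.splits_univ
  · rcases cases_n n with rfl | ⟨h1, h2⟩ | h1
    · omega
    · rw [Lb n h1 h2]
      obtain ⟨h3, h4, h5, -⟩ := hs n h1 h2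
      exact ⟨by simpa using h5 q hqn, (hside q _ h3 (h4 q)).1 (h5 q hqn)⟩
    · rw [Lu n h1]
      refine ⟨trivial, ?_⟩
      rw [Set.compl_univ, Set.indicator_empty]
      exact h1Norm_zero.trans_le hδ
  · rcases cases_n n with rfl | ⟨h1, h2⟩ | h1
    · rw [L0]
      refine ⟨fun h => h, ?_⟩
      rw [Set.indicator_empty]
      exact h1Norm_zero.trans_le hδ
    · rw [Lb n h1 h2]
      obtain ⟨h3, h4, -, h5⟩ := hs n h1 h2
      exact ⟨by simpa using (h5 q hnq).le, (hside q _ h3 (h4 q)).2 (h5 q hnq)⟩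
    · have := q.2
      omega

/-! ### Perturbation of the decoupled Nehari system -/

/-- The space of the coefficients of a system of `h` quadratic and quartic forms in `h` unknowns. -/
abbrev Coefficients (h : ℕ) : Type :=
  (Fin h → Fin h → Fin h → ℝ) × (Fin h → (Fin 4 → Fin h) → ℝ)

/-- The decoupled system `t_l² - t_l⁴ = 0`, perturbed by a quadratic and a quartic form. -/
def perturbedSystem (p : (Fin h → ℝ) × Coefficients h) (l : Fin h) : ℝ :=
  p.1 l ^ 2 - p.1 l ^ 4 + (∑ i, ∑ j, p.2.1 l i j * (p.1 i * p.1 j)) -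
    ∑ J, p.2.2 l J * ∏ i, p.1 (J i)

theorem contDiff_perturbedSystem : ContDiff ℝ 1 (perturbedSystem (h := h)) := by
  rw [contDiff_pi]
  intro l
  unfold perturbedSystem
  fun_prop

/-- The perturbed system has a positive solution if the perturbation is small: the decoupled system
has the nondegenerate solution `(1, …, 1)`, at which the map `(t, c) ↦ (F(t, c), c)` is open. -/
theorem exists_solution_perturbedSystem (h : ℕ) :
    ∃ τ : ℝ, 0 < τ ∧ ∀ c : Coefficients h, (∀ l i j, |c.1 l i j| ≤ τ) → (∀ l J, |c.2 l J| ≤ τ) →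
      ∃ t : Fin h → ℝ, (∀ l, 0 < t l) ∧ ∀ l, perturbedSystem (t, c) l = 0 := by
  set F := perturbedSystem (h := h) with hF
  set p₀ : (Fin h → ℝ) × Coefficients h := (1, 0) with hp₀
  have hstrict : HasStrictFDerivAt F (fderiv ℝ F p₀) p₀ :=
    contDiff_perturbedSystem.contDiffAt.hasStrictFDerivAt (by simp)
  set A := fderiv ℝ F p₀ with hA
  have hAμ : ∀ μ : Fin h → ℝ, A (μ, 0) = (-2 : ℝ) • μ := by
    intro μ
    have hin : HasFDerivAt (fun t : Fin h → ℝ => ((t, 0) : (Fin h → ℝ) × Coefficients h))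
        (ContinuousLinearMap.inl ℝ (Fin h → ℝ) (Coefficients h)) 1 :=
      (ContinuousLinearMap.inl ℝ (Fin h → ℝ) (Coefficients h)).hasFDerivAt
    have h1 := HasFDerivAt.comp (𝕜 := ℝ) (1 : Fin h → ℝ) hstrict.hasFDerivAt hin
    have h2 : (F ∘ fun t : Fin h → ℝ => ((t, 0) : (Fin h → ℝ) × Coefficients h)) =
        fun t l => t l ^ 2 - t l ^ 4 := by
      ext t l
      simp [hF, perturbedSystem]
    rw [h2] at h1
    have h3 : HasFDerivAt (fun (t : Fin h → ℝ) (l : Fin h) => t l ^ 2 - t l ^ 4)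
        (ContinuousLinearMap.pi fun l =>
          (-2 : ℝ) • (ContinuousLinearMap.proj (R := ℝ) (φ := fun _ : Fin h => ℝ) l)) 1 := by
      rw [hasFDerivAt_pi]
      intro l
      have h4 : HasFDerivAt (fun t : Fin h → ℝ => t l)
          (ContinuousLinearMap.proj (R := ℝ) (φ := fun _ : Fin h => ℝ) l) 1 :=
        (ContinuousLinearMap.proj (R := ℝ) (φ := fun _ : Fin h => ℝ) l).hasFDerivAt
      have h5 : HasDerivAt (fun r : ℝ => r ^ 2 - r ^ 4) (-2) ((1 : Fin h → ℝ) l) := by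
        have := (hasDerivAt_pow 2 (1 : ℝ)).sub (hasDerivAt_pow 4 (1 : ℝ))
        norm_num at this
        exact this
      exact h5.comp_hasFDerivAt (1 : Fin h → ℝ) h4
    have h6 := h1.unique h3
    have h7 := congrArg (fun T => T μ) h6
    ext l
    simpa using congrFun h7 l
  have hmap := (hstrict.prodMk hasStrictFDerivAt_snd).map_nhds_eq_of_surj (by
    rw [LinearMap.range_eq_top]
    rintro ⟨e, γ⟩
    refine ⟨((-2 : ℝ)⁻¹ • (e - A (0, γ)), γ), ?_⟩
    have h1 : A ((-2 : ℝ)⁻¹ • (e - A (0, γ)), γ) =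
        A ((-2 : ℝ)⁻¹ • (e - A (0, γ)), 0) + A (0, γ) := by
      rw [← map_add]
      simp
    have h2 : A ((-2 : ℝ)⁻¹ • (e - A (0, γ)), γ) = e := by
      rw [h1, hAμ, smul_smul]
      norm_num
    simpa using h2)
  have hval : (F p₀, p₀.2) = ((0 : Fin h → ℝ), (0 : Coefficients h)) := by
    refine Prod.ext ?_ rfl
    ext l
    simp [hF, hp₀, perturbedSystem]
  have hU : {p : (Fin h → ℝ) × Coefficients h | ∀ l, 0 < p.1 l} ∈ nhds p₀ := by
    refine IsOpen.mem_nhds ?_ (by simp [hp₀])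
    simp only [Set.ofPred_forall]
    exact isOpen_iInter_of_finite fun l => isOpen_lt continuous_const (by fun_prop)
  have himg := Filter.image_mem_map (m := fun p => (F p, p.2)) hU
  rw [hmap, hval] at himg
  obtain ⟨τ, hτ, hball⟩ := Metric.mem_nhds_iff.1 himg
  refine ⟨τ / 2, by positivity, fun c h1 h2 => ?_⟩
  have hc : ‖c‖ ≤ τ / 2 := by
    refine norm_prod_le_iff.2 ⟨?_, ?_⟩
    · refine (pi_norm_le_iff_of_nonneg (by positivity)).2 fun l => ?_
      refine (pi_norm_le_iff_of_nonneg (by positivity)).2 fun i => ?_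
      exact (pi_norm_le_iff_of_nonneg (by positivity)).2 fun j => h1 l i j
    · refine (pi_norm_le_iff_of_nonneg (by positivity)).2 fun l => ?_
      exact (pi_norm_le_iff_of_nonneg (by positivity)).2 fun J => h2 l J
  have hmem : ((0 : Fin h → ℝ), c) ∈ Metric.ball ((0 : Fin h → ℝ), (0 : Coefficients h)) τ := by
    rw [mem_ball_iff_norm, Prod.mk_sub_mk, sub_zero, sub_zero, Prod.norm_mk, norm_zero,
      max_eq_right (norm_nonneg _)]
    linarith
  obtain ⟨⟨t, c'⟩, ht, heq⟩ := hball hmem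
  simp only [Prod.mk.injEq] at heq
  obtain ⟨h3, rfl⟩ := heq
  exact ⟨t, ht, fun l => congrFun h3 l⟩

theorem normSq_sum_mul (P : Fin h → Space N → ℝ) (hP : ∀ q, MemH1Radial (P q)) (t : Fin h → ℝ) :
    normSq (fun x => ∑ q, t q * P q x) = ∑ i, ∑ j,
      inner ℝ (graphMap N ⟨P i, hP i⟩) (graphMap N ⟨P j, hP j⟩) * (t i * t j) := by
  have e : (fun x => ∑ q, t q * P q x) =
      (∑ q, t q • (⟨P q, hP q⟩ : radialH1 N) : radialH1 N).1 := by
    ext x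
    simp
  rw [e, ← norm_graphMap_sq, map_sum, ← real_inner_self_eq_norm_sq, sum_inner]
  refine Finset.sum_congr rfl fun i _ => ?_
  rw [inner_sum]
  refine Finset.sum_congr rfl fun j _ => ?_
  rw [map_smul, map_smul, real_inner_smul_left, real_inner_smul_right]
  ring

theorem integral_sum_mul_pow_four (hN : N = 2 ∨ N = 3) (P : Fin h → Space N → ℝ)
    (hP : ∀ q, MemH1Radial (P q)) (t : Fin h → ℝ) :
    ∫ x, (∑ q, t q * P q x) ^ 4 = ∑ J : Fin 4 → Fin h,
      (∫ x, P (J 0) x * P (J 1) x * (P (J 2) x * P (J 3) x)) * ∏ i, t (J i) := by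
  have e : ∀ x, (∑ q, t q * P q x) ^ 4 = ∑ J : Fin 4 → Fin h,
      (P (J 0) x * P (J 1) x * (P (J 2) x * P (J 3) x)) * ∏ i, t (J i) := by
    intro x
    rw [Fintype.sum_pow]
    refine Finset.sum_congr rfl fun J _ => ?_
    rw [Finset.prod_mul_distrib, Fin.prod_univ_four (fun i => P (J i) x)]
    ring
  rw [integral_congr_ae (.of_forall e), integral_finsetSum _ fun J _ =>
    (integrable_mul_four hN (hP _) (hP _) (hP _) (hP _)).mul_const _]
  exact Finset.sum_congr rfl fun J _ => integral_mul_const _ _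

theorem memH1Radial_sum_mul {P : Fin h → Space N → ℝ} (hP : ∀ q, MemH1Radial (P q))
    (t : Fin h → ℝ) : MemH1Radial (fun x => ∑ q, t q * P q x) := by
  have e : (fun x => ∑ q, t q * P q x) = ∑ q, t q • P q := by
    ext x
    simp
  rw [e]
  exact (radialH1 N).sum_mem fun q _ => (radialH1 N).smul_mem _ (hP q)

theorem abs_inner_graphMap_le {u v : Space N → ℝ} (hu : MemH1Radial u) (hv : MemH1Radial v) :
    |inner ℝ (graphMap N ⟨u, hu⟩) (graphMap N ⟨v, hv⟩)| ≤ h1Norm u * h1Norm v := by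
  rw [h1Norm, h1Norm, sqrt_normSq hu, sqrt_normSq hv]
  exact abs_real_inner_le_norm _ _

/-- If the matrix of functions `P l q` is nearly diagonal, with diagonal entries close to a tuple
on the Nehari manifold, then suitable positive combinations of its rows lie on the Nehari
manifold. -/
theorem exists_nehari_combination (hN : N = 2 ∨ N = 3) (h : ℕ) (R : ℝ) (hR : 1 ≤ R) (m : ℝ)
    (hm : 0 < m) :
    ∃ δ : ℝ, 0 < δ ∧ δ ≤ 1 ∧ ∀ P : Fin h → Fin h → Space N → ℝ, (∀ l q, MemH1Radial (P l q)) →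
      (∀ l q, h1Norm (P l q) ≤ R) → (∀ l q, q ≠ l → h1Norm (P l q) ≤ δ) →
      ∀ w : Fin h → Space N → ℝ, (∀ l, MemH1Radial (w l)) → (∀ l, h1Norm (w l) ≤ R) →
      (∀ l, m ≤ normSq (w l)) → (∀ l, normSq (w l) = ∫ x, w l x ^ 4) →
      (∀ l, h1Norm (P l l - w l) ≤ 3 * δ) →
      ∃ t : Fin h → ℝ, (∀ q, 0 < t q) ∧ ∀ l,
        normSq (fun x => ∑ q, t q * P l q x) = ∫ x, (∑ q, t q * P l q x) ^ 4 := by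
  obtain ⟨τ, hτ, hsolve⟩ := exists_solution_perturbedSystem h
  obtain ⟨C₁, hC₁, hT⟩ := exists_abs_integral_mul_four_le hN
  obtain ⟨C₂, hC₂, hI⟩ := exists_abs_integral_pow_four_sub_le hN
  -- `D δ` dominates all the errors.
  set D : ℝ := C₁ * R ^ 3 + 3 * C₂ * R ^ 3 + 6 * R with hD
  have hD0 : 0 < D := by positivity
  set δ := min 1 (m / (2 * D) * min τ 1) with hδ
  have hδ0 : 0 < δ := by positivity
  have d0 : D * δ ≤ m / 2 * min τ 1 := by
    calc D * δ ≤ D * (m / (2 * D) * min τ 1) := by gcongr; exact min_le_right _ _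
      _ = _ := by field_simp
  have d1 : D * δ ≤ m / 2 := d0.trans (mul_le_of_le_one_right (by positivity) (min_le_right _ _))
  have d2 : D * δ ≤ τ * (m / 2) :=
    d0.trans (by rw [mul_comm]; gcongr; exact min_le_left _ _)
  refine ⟨δ, hδ0, min_le_left _ _, fun P hP hPR hPδ w hw hwR hwm hwne hPw => ?_⟩
  clear_value δ
  have hP0 : ∀ l q, 0 ≤ h1Norm (P l q) := fun l q => h1Norm_nonneg _
  set α : Fin h → ℝ := fun l => normSq (P l l) with hα
  have hαw : ∀ l, |α l - normSq (w l)| ≤ 6 * R * δ := by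
    intro l
    have h1 := h1Norm_le_add (hP l l) (hw l)
    have h2 := h1Norm_le_add (hw l) (hP l l)
    rw [h1Norm_sub_comm (hw l) (hP l l)] at h2
    have h3 := hPw l
    have h4 := hPR l l
    have h5 := hwR l
    have h6 := hP0 l l
    have h7 := h1Norm_nonneg (w l)
    rw [hα]
    simp only
    rw [← h1Norm_sq, ← h1Norm_sq]
    have h8 : |h1Norm (P l l) - h1Norm (w l)| ≤ 3 * δ := abs_le.2 ⟨by linarith, by linarith⟩
    have h9 : |h1Norm (P l l) + h1Norm (w l)| ≤ 2 * R := abs_le.2 ⟨by linarith, by linarith⟩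
    calc _ = |h1Norm (P l l) - h1Norm (w l)| * |h1Norm (P l l) + h1Norm (w l)| := by
          rw [← abs_mul]
          congr 1
          ring
      _ ≤ 3 * δ * (2 * R) := mul_le_mul h8 h9 (abs_nonneg _) (by positivity)
      _ = _ := by ring
  have hβw : ∀ l, |(∫ x, P l l x ^ 4) - normSq (w l)| ≤ 3 * C₂ * R ^ 3 * δ := by
    intro l
    rw [hwne l]
    calc _ ≤ C₂ * R ^ 3 * h1Norm (P l l - w l) := hI R _ _ (hP l l) (hw l) (hPR l l) (hwR l)
      _ ≤ C₂ * R ^ 3 * (3 * δ) := by gcongr; exact hPw l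
      _ = _ := by ring
  have hR3 : 0 < R ^ 3 := by positivity
  have hDδ : D * δ = C₁ * R ^ 3 * δ + 3 * C₂ * R ^ 3 * δ + 6 * R * δ := by rw [hD]; ring
  have p1 : 0 < C₁ * R ^ 3 * δ := by positivity
  have p2 : 0 < 3 * C₂ * R ^ 3 * δ := by positivity
  have p3 : 0 < 6 * R * δ := by positivity
  have hαm : ∀ l, m / 2 ≤ α l := by
    intro l
    have h1 := (abs_le.1 (hαw l)).1
    have h2 := hwm l
    linarith
  have hα0 : ∀ l, 0 < α l := fun l => (by positivity : 0 < m / 2).trans_le (hαm l)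
  -- errors bounded by `D δ` become bounded by `τ` after division by `α l`
  have hdiv : ∀ l e, |e| ≤ D * δ → |e / α l| ≤ τ := by
    intro l e he
    rw [abs_div, abs_of_pos (hα0 l), div_le_iff₀ (hα0 l)]
    calc |e| ≤ τ * (m / 2) := he.trans d2
      _ ≤ τ * α l := by gcongr; exact hαm l
  set B : Fin h → Fin h → Fin h → ℝ := fun l i j =>
    inner ℝ (graphMap N ⟨P l i, hP l i⟩) (graphMap N ⟨P l j, hP l j⟩) with hB
  set T : Fin h → (Fin 4 → Fin h) → ℝ := fun l J =>
    ∫ x, P l (J 0) x * P l (J 1) x * (P l (J 2) x * P l (J 3) x) with hTdef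
  have hBl : ∀ l, B l l l = α l := fun l => by
    rw [hB, hα]
    simp only
    rw [real_inner_self_eq_norm_sq, norm_graphMap_sq]
  have hTl : ∀ l, T l (fun _ => l) = ∫ x, P l l x ^ 4 := fun l =>
    integral_congr_ae (.of_forall fun x => by ring)
  have hBoff : ∀ l i j, ¬ (i = l ∧ j = l) → |B l i j| ≤ R * δ := by
    intro l i j hij
    refine (abs_inner_graphMap_le (hP l i) (hP l j)).trans ?_
    rcases not_and_or.1 hij with h1 | h1
    · rw [mul_comm R]
      exact mul_le_mul (hPδ l i h1) (hPR l j) (hP0 _ _) hδ0.le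
    · exact mul_le_mul (hPR l i) (hPδ l j h1) (hP0 _ _) (by linarith)
  have hToff : ∀ l J, J ≠ (fun _ => l) → |T l J| ≤ C₁ * R ^ 3 * δ := by
    intro l J hJ
    refine (hT _ _ _ _ (hP _ _) (hP _ _) (hP _ _) (hP _ _)).trans ?_
    rw [mul_assoc C₁]
    refine mul_le_mul_of_nonneg_left ?_ hC₁.le
    have hprod : ∀ a b c d : ℝ, 0 ≤ a → 0 ≤ b → 0 ≤ c → 0 ≤ d → a ≤ δ → b ≤ R → c ≤ R → d ≤ R →
        a * b * (c * d) ≤ R ^ 3 * δ := by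
      intro a b c d ha hb hc hd ha' hb' hc' hd'
      calc a * b * (c * d) ≤ δ * R * (R * R) := by gcongr
        _ = _ := by ring
    obtain ⟨i, hi⟩ := Function.ne_iff.1 hJ
    have hsmall := hPδ l (J i) hi
    fin_cases i
    · exact hprod _ _ _ _ (hP0 _ _) (hP0 _ _) (hP0 _ _) (hP0 _ _) hsmall (hPR _ _) (hPR _ _)
        (hPR _ _)
    · rw [mul_comm (h1Norm (P l (J 0)))]
      exact hprod _ _ _ _ (hP0 _ _) (hP0 _ _) (hP0 _ _) (hP0 _ _) hsmall (hPR _ _) (hPR _ _)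
        (hPR _ _)
    · rw [mul_comm (h1Norm (P l (J 0)) * _)]
      exact hprod _ _ _ _ (hP0 _ _) (hP0 _ _) (hP0 _ _) (hP0 _ _) hsmall (hPR _ _) (hPR _ _)
        (hPR _ _)
    · rw [mul_comm (h1Norm (P l (J 0)) * _), mul_comm (h1Norm (P l (J 2)))]
      exact hprod _ _ _ _ (hP0 _ _) (hP0 _ _) (hP0 _ _) (hP0 _ _) hsmall (hPR _ _) (hPR _ _)
        (hPR _ _)
  -- the coefficients of the Nehari system, divided by `α l`, minus those of the decoupled one
  set c : Coefficients h :=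
    (fun l i j => B l i j / α l - if i = l ∧ j = l then 1 else 0,
      fun l J => T l J / α l - if J = (fun _ => l) then 1 else 0) with hc
  have hc₁ : ∀ l i j, |c.1 l i j| ≤ τ := by
    intro l i j
    simp only [hc]
    by_cases hij : i = l ∧ j = l
    · obtain ⟨rfl, rfl⟩ := hij
      rw [hBl, div_self (hα0 _).ne']
      simpa using hτ.le
    · rw [if_neg hij, sub_zero]
      refine hdiv l _ ((hBoff l i j hij).trans ?_)
      have : 0 < R * δ := by positivity
      linarith
  have hc₂ : ∀ l J, |c.2 l J| ≤ τ := by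
    intro l J
    simp only [hc]
    by_cases hJ : J = fun _ => l
    · rw [if_pos hJ, hJ, hTl, div_sub_one (hα0 l).ne']
      refine hdiv l _ ?_
      have h1 := abs_le.1 (hαw l)
      have h2 := abs_le.1 (hβw l)
      exact abs_le.2 ⟨by linarith [h1.1, h1.2, h2.1, h2.2], by linarith [h1.1, h1.2, h2.1, h2.2]⟩
    · rw [if_neg hJ, sub_zero]
      refine hdiv l _ ((hToff l J hJ).trans ?_)
      linarith
  obtain ⟨t, ht, hsol⟩ := hsolve c hc₁ hc₂
  refine ⟨t, ht, fun l => ?_⟩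
  have h1 := hsol l
  rw [normSq_sum_mul _ (hP l), integral_sum_mul_pow_four hN _ (hP l)]
  simp only [perturbedSystem, hc, sub_mul, Finset.sum_sub_distrib] at h1
  have s1 : ∑ i, ∑ j, (if i = l ∧ j = l then (1 : ℝ) else 0) * (t i * t j) = t l ^ 2 := by
    rw [Finset.sum_eq_single l, Finset.sum_eq_single l]
    · simp [sq]
    · intro j _ hj
      simp [hj]
    · simp
    · intro i _ hi
      simp [hi]
    · simp
  have s2 : ∑ J : Fin 4 → Fin h, (if J = (fun _ => l) then (1 : ℝ) else 0) * ∏ i, t (J i) =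
      t l ^ 4 := by
    rw [Finset.sum_eq_single (fun _ => l)]
    · simp
    · intro J _ hJ
      simp [hJ]
    · simp
  rw [s1, s2] at h1
  have h2 : ∑ i, ∑ j, B l i j / α l * (t i * t j) =
      (∑ i, ∑ j, B l i j * (t i * t j)) / α l := by
    simp only [Finset.sum_div]
    exact Finset.sum_congr rfl fun i _ => Finset.sum_congr rfl fun j _ => by ring
  have h3 : ∑ J, T l J / α l * ∏ i, t (J i) = (∑ J, T l J * ∏ i, t (J i)) / α l := by
    simp only [Finset.sum_div]
    exact Finset.sum_congr rfl fun J _ => by ring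
  rw [h2, h3] at h1
  have h4 : (∑ i, ∑ j, B l i j * (t i * t j)) / α l = (∑ J, T l J * ∏ i, t (J i)) / α l := by
    linarith
  exact (div_left_inj' (hα0 l).ne').1 h4

/-! ### The energy of families near a minimizer -/

theorem sum_indicator_levels {L : ℕ → Set (Space N)} (h0 : L 0 = ∅) (hh : L h = Set.univ)
    (hL : Monotone L) (u : Space N → ℝ) (x : Space N) :
    ∑ l : Fin h, (L (l + 1) ∩ (L l)ᶜ).indicator u x = u x := by
  have e : ∀ n : ℕ, (L (n + 1) ∩ (L n)ᶜ).indicator u x =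
      (L (n + 1)).indicator u x - (L n).indicator u x := by
    intro n
    have hsub := hL (Nat.le_succ n)
    by_cases h1 : x ∈ L n
    · simp [h1, hsub h1]
    · by_cases h2 : x ∈ L (n + 1) <;> simp [h1, h2]
  rw [Fin.sum_univ_eq_sum_range (fun n => (L (n + 1) ∩ (L n)ᶜ).indicator u x) h]
  simp_rw [e]
  rw [Finset.sum_range_sub (fun n => (L n).indicator u x), h0, hh]
  simp

/-- A family near a minimizer, whose consecutive members belong to components with disjoint
supports, has a positive combination with energy at least the Nehari level. -/
theorem exists_combination_energy_ge (hN : N = 2 ∨ N = 3) (hh : 0 < h) {k : ℕ} {σ : Fin h → Fin k}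
    (hσ : ∀ l p : Fin h, (p : ℕ) = l + 1 → σ p ≠ σ l) :
    ∃ ε : ℝ, 0 < ε ∧ ε ≤ 1 ∧ ∀ w ∈ minimizers N h, ∀ v : Fin h → Space N → ℝ,
      (∀ q, MemH1Radial (v q)) → (∀ q x, x ≠ 0 → 0 ≤ v q x) →
      (∀ q, h1Norm (v q - w q) ≤ ε) →
      (∀ q p, σ q ≠ σ p → ∀ x, x ≠ 0 → v q x * v p x = 0) →
      ∃ t : Fin h → ℝ, (∀ q, 0 < t q) ∧
        nehariLevel N h ≤ ((energy (fun x => ∑ q, t q * v q x) : ℝ) : EReal) := by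
  have : NeZero N := ⟨by omega⟩
  rcases Set.eq_empty_or_nonempty (minimizers N h) with hempty | ⟨w₀, hw₀⟩
  · exact ⟨1, one_pos, le_rfl, fun w hw => by simp [hempty] at hw⟩
  set c := energy (fun x => ∑ l, w₀ l x) with hc
  have hcl : (c : EReal) = nehariLevel N h := hw₀.2
  set R := √(4 * c) + 1 with hRdef
  have hR : 1 ≤ R := by
    have := Real.sqrt_nonneg (4 * c)
    linarith
  obtain ⟨m, hm, hge⟩ := exists_normSq_ge hN
  obtain ⟨δ, hδ, hδ1, hcomb⟩ := exists_nehari_combination hN h (R + 1) (by linarith) m hm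
  obtain ⟨ε₀, hε₀, hε₀1, hpeaks⟩ := exists_peaks (h := h) hN R hR δ hδ
  refine ⟨min ε₀ δ, lt_min hε₀ hδ, (min_le_left _ _).trans hε₀1, fun w hw v hv hv0 hvw hdisj => ?_⟩
  have hwm := hw.1.1
  have hwR : ∀ q, h1Norm (w q) ≤ R := fun q => by
    have h1 := Real.sqrt_le_sqrt (normSq_le_of_mem_minimizers hN hw hcl q)
    unfold h1Norm
    linarith
  have hvδ : ∀ q, h1Norm (v q - w q) ≤ δ := fun q => (hvw q).trans (min_le_right _ _)
  have hvR : ∀ q, h1Norm (v q) ≤ R + 1 := fun q => by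
    have h1 := h1Norm_le_add (hv q) (hwm.mem q)
    have h2 := hvδ q
    have h3 := hwR q
    linarith
  obtain ⟨z, hz, hside⟩ := hpeaks w hw hwR v hv hv0 fun q => (hvw q).trans (min_le_left _ _)
  have hmono : ∀ l p, l < p → ‖z l‖ < ‖z p‖ := by
    intro l p hlp
    by_contra hcon
    exact (hz p).2.1.ne' (hwm.ordered_gt l p hlp (z l) (z p) (hz l).1 (hz p).1 (hz l).2.1
      (not_lt.1 hcon))
  obtain ⟨L, hL0, hLh, hLm, hLd, hLs, hLlt, hLge⟩ := exists_levels hh hσ hv hv0 hdisj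
    (fun q => ⟨(hz q).1, (hz q).2.2⟩) hmono hδ.le hside
  -- `v q` splits along every sphere, and so do its pieces
  have hs1 : ∀ q n, Splits (L n) (v q) := fun q n => hLs (v q) (hv q) (fun x hx => hx q) n
  have hs2 : ∀ q n n', Splits (L n') ((L n)ᶜ.indicator (v q)) := fun q n n' =>
    hLs _ ((hs1 q n).compl (hv q)).mem (fun x hx => by simp [hx q]) n'
  -- the part of `v q` in the `l`-th annulus
  set P : Fin h → Fin h → Space N → ℝ := fun l q =>
    (L (l + 1) ∩ (L l)ᶜ).indicator (v q) with hP
  have hsP : ∀ l q : Fin h, Splits (L (l + 1) ∩ (L l)ᶜ) (v q) := fun l q =>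
    ((hs1 q l).compl (hv q)).inter (hs2 q l (l + 1))
  have hPm : ∀ l q, MemH1Radial (P l q) := fun l q => (hsP l q).mem
  have hPin : ∀ l q, h1Norm (P l q) ≤ h1Norm ((L l)ᶜ.indicator (v q)) := by
    intro l q
    have h1 := (hs2 q l (l + 1)).h1Norm_indicator_le ((hs1 q l).compl (hv q)).mem
    rwa [Set.indicator_indicator] at h1
  have hPout : ∀ l q, h1Norm (P l q) ≤ h1Norm ((L (l + 1)).indicator (v q)) := by
    intro l q
    have h1 : Splits (L l) ((L (l + 1)).indicator (v q)) :=
      hLs _ (hs1 q _).mem (fun x hx => by simp [hx q]) l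
    have h2 := (h1.compl (hs1 q _).mem).h1Norm_indicator_le (hs1 q _).mem
    rwa [Set.indicator_indicator, Set.inter_comm] at h2
  have hPsmall : ∀ l q, q ≠ l → h1Norm (P l q) ≤ δ := by
    intro l q hql
    rcases lt_or_gt_of_ne hql with h1 | h1
    · exact (hPin l q).trans (hLlt q l h1).2
    · exact (hPout l q).trans (hLge q (l + 1) h1).2
  have hPdiag : ∀ l, h1Norm (P l l - w l) ≤ 3 * δ := by
    intro l
    have e : v l - P l l = (L (l + 1))ᶜ.indicator (v l) + (L l).indicator (v l) := by
      ext x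
      have hsub := hLm (Nat.le_succ (l : ℕ))
      by_cases h1 : x ∈ L l
      · simp [hP, h1, hsub h1]
      · by_cases h2 : x ∈ L (l + 1) <;> simp [hP, h1, h2]
    have h1 := h1Norm_add_le ((hs1 l (l + 1)).compl (hv l)).mem (hs1 l l).mem
    rw [← e, h1Norm_sub_comm (hv l) (hPm l l)] at h1
    have h2 := (hLlt l (l + 1) (Nat.lt_succ_self _)).2
    have h3 := (hLge l l le_rfl).2
    have h4 := h1Norm_add_le ((hPm l l).sub (hv l)) ((hv l).sub (hwm.mem l))
    rw [sub_add_sub_cancel] at h4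
    have h5 := hvδ l
    linarith
  obtain ⟨t, ht, hne⟩ := hcomb P hPm
    (fun l q => ((hsP l q).h1Norm_indicator_le (hv q)).trans (hvR q)) hPsmall w hwm.mem
    (fun l => (hwR l).trans (by linarith))
    (fun l => hge (w l) (hwm.mem l) (hwm.nontrivial l) (hw.1.2 l)) hw.1.2 hPdiag
  refine ⟨t, ht, ?_⟩
  set W : Fin h → Space N → ℝ := fun l x => ∑ q, t q * P l q x with hW
  have hPnn : ∀ l q x, x ≠ 0 → 0 ≤ P l q x := fun l q x hx =>
    Set.indicator_apply_nonneg fun _ => hv0 q x hx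
  have hWzero : ∀ (l : Fin h) x, x ∉ L (l + 1) ∩ (L l)ᶜ → W l x = 0 := fun l x hx =>
    Finset.sum_eq_zero fun q _ => by simp only [hP]; rw [Set.indicator_of_notMem hx, mul_zero]
  have hWmem : ∀ (l : Fin h) x, 0 < W l x → x ∈ L (l + 1) ∧ x ∉ L l := by
    intro l x hx
    by_contra hcon
    exact hx.ne' (hWzero l x hcon)
  have hWnehari : W ∈ nehariSet N h := by
    refine ⟨⟨fun l => memH1Radial_sum_mul (hPm l) t, fun l x hx => ?_, fun l => ?_,
      fun l p hpl x₀ x hx₀ hx hl hle => ?_, fun l p hpl x₀ x hx₀ hx hl hle => ?_⟩, hne⟩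
    · exact Finset.sum_nonneg fun q _ => mul_nonneg (ht q).le (hPnn l q x hx)
    · refine ⟨z l, (hz l).1, (Finset.sum_pos' (fun q _ =>
        mul_nonneg (ht q).le (hPnn l q _ (hz l).1)) ⟨l, Finset.mem_univ _, ?_⟩).ne'⟩
      have hzl : z l ∈ L (l + 1) ∩ (L l)ᶜ :=
        ⟨(hLlt l (l + 1) (Nat.lt_succ_self _)).1, (hLge l l le_rfl).1⟩
      simp only [hP]
      rw [Set.indicator_of_mem hzl]
      exact mul_pos (ht l) (hz l).2.2
    · refine hWzero p x fun hxp => (hWmem l x₀ hl).2 ?_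
      exact hLm (Nat.succ_le_of_lt hpl) (hLd _ x x₀ hle hxp.1)
    · refine hWzero p x fun hxp => hxp.2 ?_
      exact hLm (Nat.succ_le_of_lt hpl) (hLd _ x₀ x hle (hWmem l x₀ hl).1)
  have hsum : (fun x => ∑ q, t q * v q x) = fun x => ∑ l, W l x := by
    ext x
    simp only [hW]
    rw [Finset.sum_comm]
    refine Finset.sum_congr rfl fun q _ => ?_
    rw [← Finset.mul_sum, sum_indicator_levels hL0 hLh hLm]
  rw [hsum]
  exact iInf₂_le W hWnehari

/-! ### Families indexed by components -/

theorem apply_pulseIndex {h k : ℕ} (σ : Fin h → Fin k) (i : Fin k) (m : Fin (pulseCount σ i)) :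
    σ (pulseIndex σ i m) = i := by
  have : pulseIndex σ i m ∈ fiber σ i := Finset.orderEmbOfFin_mem _ _ _
  simpa [fiber] using this

theorem bijective_pulseIndex {h k : ℕ} (σ : Fin h → Fin k) :
    Function.Bijective fun p : (i : Fin k) × Fin (pulseCount σ i) => pulseIndex σ p.1 p.2 := by
  constructor
  · rintro ⟨i, m⟩ ⟨j, n⟩ hmn
    simp only at hmn
    have hij : i = j := by
      have h1 := apply_pulseIndex σ i m
      rw [hmn, apply_pulseIndex σ j n] at h1
      exact h1.symm
    subst hij
    rw [(Finset.orderEmbOfFin (fiber σ i) rfl).injective hmn]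
  · intro l
    have hl : l ∈ Set.range ((fiber σ (σ l)).orderEmbOfFin rfl) := by
      rw [Finset.range_orderEmbOfFin]
      simp [fiber]
    obtain ⟨m, hm⟩ := hl
    exact ⟨⟨σ l, m⟩, hm⟩

/-- The pairs `(i, m)` enumerate the pulses. -/
def pulseEquiv {h k : ℕ} (σ : Fin h → Fin k) : (i : Fin k) × Fin (pulseCount σ i) ≃ Fin h :=
  Equiv.ofBijective _ (bijective_pulseIndex σ)

theorem apply_eq_fst_pulseEquiv_symm {h k : ℕ} (σ : Fin h → Fin k) (q : Fin h) :
    σ q = ((pulseEquiv σ).symm q).1 := by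
  conv_lhs => rw [← (pulseEquiv σ).apply_symm_apply q]
  exact apply_pulseIndex σ _ _

theorem memH1Radial_component {h k : ℕ} {σ : Fin h → Fin k} {v : PulseFamily N σ}
    (hv : ∀ i m, MemH1Radial (v i m)) (i : Fin k) : MemH1Radial (component v i) := by
  have e : component v i = ∑ m, v i m := by
    ext x
    simp [component]
  rw [e]
  exact (radialH1 N).sum_mem fun m _ => hv i m

end MixedNehari
end

theorem mainTheorem3 (N : ℕ) (hN : N = 2 ∨ N = 3) (h k : ℕ) (hk : 3 ≤ k)
    (σ : Fin h → Fin k) (hσ : MixedNehari.IsAdmissible σ) :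
    ∃ ε₀ : ℝ, 0 < ε₀ ∧ ε₀ ≤ 1 ∧ ∀ ε : ℝ, 0 < ε → ε < ε₀ →
      ∀ v ∈ MixedNehari.nearMinimizers N σ ε,
        (∀ i j : Fin k, i ≠ j → ∀ᵐ x : MixedNehari.Space N,
          MixedNehari.component v i x * MixedNehari.component v j x = 0) →
        MixedNehari.nehariLevel N h ≤
          ⨆ (c : (i : Fin k) → Fin (MixedNehari.pulseCount σ i) → ℝ) (_ : ∀ i m, 0 < c i m),
            ((MixedNehari.energy (fun x => ∑ i, ∑ m, c i m * v i m x) : ℝ) : EReal) := by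
  open MixedNehari in
  obtain ⟨l₀, -⟩ := hσ.surjective ⟨0, by omega⟩
  obtain ⟨ε₀, hε₀, hε₀1, hmain⟩ :=
    exists_combination_energy_ge hN l₀.pos (σ := σ) fun l p hlp => hσ.consecutive l p hlp
  refine ⟨ε₀, hε₀, hε₀1, fun ε hε hεε₀ v hv hdisj => ?_⟩
  obtain ⟨hvm, hv0, w, hw, hclose⟩ := hv
  set e := pulseEquiv σ with he
  have hei : ∀ q, pulseIndex σ (e.symm q).1 (e.symm q).2 = q := fun q => e.apply_symm_apply q
  -- disjointness a.e. is disjointness everywhere, by continuity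
  have hdisj' : ∀ i j, i ≠ j → ∀ x, x ≠ 0 → component v i x * component v j x = 0 :=
    fun i j hij x hx => eq_zero_of_ae_eq_zero
      ((memH1Radial_component hvm i).continuousOn.mul (memH1Radial_component hvm j).continuousOn)
      (hdisj i j hij) hx
  have hzero : ∀ i m x, x ≠ 0 → component v i x = 0 → v i m x = 0 := fun i m x hx h0 =>
    (Finset.sum_eq_zero_iff_of_nonneg fun n _ => hv0 i n x hx).1 h0 m (Finset.mem_univ m)
  set v' : Fin h → Space N → ℝ := fun q => v (e.symm q).1 (e.symm q).2 with hv'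
  have hnear : ∀ q, h1Norm (v' q - w q) ≤ ε₀ := by
    intro q
    refine Real.sqrt_le_iff.2 ⟨hε₀.le, ?_⟩
    have h1 := Finset.single_le_sum
      (f := fun i => ∑ m, normSq (fun x => v i m x - w (pulseIndex σ i m) x))
      (fun i _ => Finset.sum_nonneg fun m _ => normSq_nonneg _) (Finset.mem_univ (e.symm q).1)
    have h2 := Finset.single_le_sum
      (f := fun m => normSq (fun x => v (e.symm q).1 m x - w (pulseIndex σ (e.symm q).1 m) x))
      (fun m _ => normSq_nonneg _) (Finset.mem_univ (e.symm q).2)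
    simp only [hei] at h2
    have h3 : ε ^ 2 ≤ ε₀ ^ 2 := by gcongr
    exact (h2.trans (h1.trans hclose.le)).trans h3
  have hvdisj : ∀ q p, σ q ≠ σ p → ∀ x, x ≠ 0 → v' q x * v' p x = 0 := by
    intro q p hqp x hx
    rw [apply_eq_fst_pulseEquiv_symm σ q, apply_eq_fst_pulseEquiv_symm σ p] at hqp
    rcases mul_eq_zero.1 (hdisj' _ _ hqp x hx) with h0 | h0
    · exact mul_eq_zero.2 (.inl (hzero _ _ x hx h0))
    · exact mul_eq_zero.2 (.inr (hzero _ _ x hx h0))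
  obtain ⟨t, ht, hle⟩ := hmain w hw v' (fun q => hvm _ _) (fun q x hx => hv0 _ _ x hx) hnear hvdisj
  refine hle.trans ?_
  have hsum : (fun x => ∑ q, t q * v' q x) =
      fun x => ∑ i, ∑ m, t (pulseIndex σ i m) * v i m x := by
    ext x
    rw [← Fintype.sum_sigma' fun i m => t (pulseIndex σ i m) * v i m x,
      ← Equiv.sum_comp e.symm]
    refine Finset.sum_congr rfl fun q _ => ?_
    rw [hei]
  rw [hsum]
  exact le_iSup₂_of_le (fun i m => t (pulseIndex σ i m)) (fun i m => ht _) le_rfl
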